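/- **Setting.** Let $G=(V,E)$ be a finite simple undirected graph, each edge counted once, let $f:E\to\mathbb R$, and put $\mu(G)=\sum_{e\in E}f(e)$. Let $I\subsetneq V$ meet every connected component of $G$. Let $G'$ be the multigraph obtained by merging $I$ into one super-node $S$: edges inside $I$ are deleted, and each edge between $u\in I$ and $v\notin I$ becomes an edge between $S$ and $v$. Let $d_S$ be the degree of $S$ in $G'$. On $G'$ the function $f$ is kept on edges not incident to $S$ and set to $0$ on edges incident to $S$. Let $X$ be the random walk on $G'$ started at $S$, which moves from $u$ to $v$ with probability (number of edges between $u$ and $v$)$/d_u$. The $k$-th tour $X^{(k)}_1=S,X^{(k)}_2,\dots,X^{(k)}_{\xi_k}$ consists of the nodes visited from the $k$-th visit to $S$ until just before the next visit. Put $$W_k=\sum_{t=2}^{\xi_k}f(X^{(k)}_{t-1},X^{(k)}_t),\qquad c=\sum_{\{u,v\}\in E:\ u\in I\text{ or }v\in I}f(u,v).$$ For $m\ge1$ write $m'=\lfloor\sqrt m\rfloor$ and $$\hat\mu_m=\frac{d_S}{2m}\sum_{k=1}^mW_k+c,\qquad \hat F_h=\hat F^{(m)}_h=\frac{d_S}{2m'}\sum_{k=(h-1)m'+1}^{hm'}W_k+c\quad(h\ge1).$$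 **Approximate Bayesian model.** Let $\mu_0\in\mathbb R$ and $m_0,\nu_0,\sigma_0>0$. The parameters $(\mu,\sigma^2)$, which stand for $\mu(G)$ and the variance of $\hat F_1$, have the prior $\mu\mid\sigma^2\sim\mathrm{Normal}(\mu_0,\sigma^2/m_0)$, $\sigma^2\sim\text{Inverse-gamma}(\nu_0/2,\nu_0\sigma_0^2/2)$. The likelihood is the large-$m$ approximation given by part 2 below: $\hat F_1,\dots,\hat F_{m'}$ are treated as i.i.d. $\mathrm{Normal}(\mu,\sigma^2)$ given $(\mu,\sigma^2)$. Let $\Pi_m$ be the marginal posterior of $\mu$, obtained from Bayes' formula (posterior density proportional to likelihood times prior density) at the batch estimates $\hat F_1,\dots,\hat F_{m'}$ observed along the random walk. **Theorem.** 1. For each $m\ge1$ the batch estimates $\hat F_h$, $h\ge1$, are i.i.d. with finite second moment, mean $\mu(G)$ and variance $\sigma_W^2/m'$, where $\sigma_W^2=(d_S/2)^2\operatorname{Var}(W_1)<\infty$. 2. For each fixed $r$, as $m\to\infty$, the vector $\big(\sqrt{m'}(\hat F_h-\mu(G))\big)_{h=1}^r$ converges in distribution to $r$ independent $\mathrm{Normal}(0,\sigma_W^2)$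 variables (point masses at $0$ if $\sigma_W=0$). 3. Almost surely under the law of the random walk, $\Pi_m$ is a probability measure for every $m\ge1$, and as $m\to\infty$ it is asymptotically the non-standardized Student $t$ distribution with density $$\phi(x\mid\nu,\tilde\mu,\tilde\sigma)=\frac{\Gamma(\frac{\nu+1}2)}{\Gamma(\frac\nu2)\,\tilde\sigma\sqrt{\pi\nu}}\Big(1+\frac{(x-\tilde\mu)^2}{\tilde\sigma^2\nu}\Big)^{-\frac{\nu+1}2},$$ in the sense that the total variation distance between the two distributions tends to $0$, where $$\nu=\nu_0+m',\qquad\tilde\mu=\frac{m_0\mu_0+m'\hat\mu_m}{m_0+m'},\qquad\tilde\sigma=\sqrt{\frac{\nu_0\sigma_0^2+\sum_{h=1}^{m'}(\hat F_h-\hat\mu_m)^2+\frac{m_0m'(\hat\mu_m-\mu_0)^2}{m_0+m'}}{(\nu_0+m')(m_0+m')}}.$$ -/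

import Mathlib

open MeasureTheory ProbabilityTheory Filter Topology
open scoped ENNReal NNReal

noncomputable section

namespace CrawlTours

section Graph

variable {V : Type*} [Fintype V] [DecidableEq V]

/-- The value `μ(G)`: the sum of the edge function `f` over the undirected edges of `G`. -/
def edgeTotal (G : SimpleGraph V) [DecidableRel G.Adj] (f : Sym2 V → ℝ) : ℝ :=
  ∑ e ∈ G.edgeFinset, f e

/-- The sum of `f` over the edges of `G` with at least one endpoint in the seed set `I`. -/
def seedTotal (G : SimpleGraph V) [DecidableRel G.Adj] (I : Finset V) (f : Sym2 V → ℝ) : ℝ :=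
  ∑ e ∈ G.edgeFinset with ∃ u ∈ I, u ∈ e, f e

/-- Nodes of the augmented multigraph: the nodes outside `I`, and the super-node `none`. -/
abbrev SuperVertex (I : Finset V) : Type _ := Option {v : V // v ∉ I}

/-- Number of edges between two nodes of the augmented multigraph.  Edges inside `I` disappear;
every edge from a node of `I` to a node `v ∉ I` becomes an edge from the super-node to `v`. -/
def edgeMult (G : SimpleGraph V) [DecidableRel G.Adj] (I : Finset V) :
    SuperVertex I → SuperVertex I → ℕ
  | none, none => 0
  | none, some v => (I.filter fun u => G.Adj u v).card
  | some v, none => (I.filter fun u => G.Adj u v).card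
  | some u, some v => if G.Adj u v then 1 else 0

/-- Degree, with multiplicity, of a node of the augmented multigraph. -/
def superDegree (G : SimpleGraph V) [DecidableRel G.Adj] (I : Finset V) (a : SuperVertex I) : ℕ :=
  ∑ b, edgeMult G I a b

/-- Transition probabilities of the random walk on the augmented multigraph. -/
def stepProb (G : SimpleGraph V) [DecidableRel G.Adj] (I : Finset V) (a b : SuperVertex I) : ℝ :=
  (edgeMult G I a b : ℝ) / (superDegree G I a : ℝ)

/-- The edge function on the augmented multigraph; it vanishes on edges at the super-node. -/
def superFun (I : Finset V) (f : Sym2 V → ℝ) : SuperVertex I → SuperVertex I → ℝ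
  | some u, some v => f s((u : V), (v : V))
  | _, _ => 0

end Graph

section Walk

variable {V : Type*} [Fintype V] [DecidableEq V] {Ω : Type*}

/-- `X` is the random walk on the augmented multigraph, started at the super-node:
the Markov chain with transition probabilities `stepProb`, given through its
finite-dimensional distributions. -/
structure IsSuperWalk [MeasurableSpace Ω] (G : SimpleGraph V) [DecidableRel G.Adj] (I : Finset V)
    (P : Measure Ω) (X : ℕ → Ω → SuperVertex I) : Prop where
  measurable : ∀ t a, MeasurableSet {ω | X t ω = a}
  law : ∀ (n : ℕ) (x : ℕ → SuperVertex I),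
    P.real {ω | ∀ t ≤ n, X t ω = x t} =
      if x 0 = none then ∏ t ∈ Finset.range n, stepProb G I (x t) (x (t + 1)) else 0

/-- Time of the `k`-th visit to the super-node; the visits are numbered from `0`, and visit `0`
is the start of the walk. -/
def visitTime {I : Finset V} (X : ℕ → Ω → SuperVertex I) (k : ℕ) (ω : Ω) : ℕ :=
  Nat.nth (fun t => X t ω = none) k

/-- The sum of the edge function along the `k`-th tour (tours are numbered from `0`), that is,
over the transitions between consecutive nodes `X_{t-1}, X_t` visited from the `k`-th visit to the
super-node until just before the next one. -/
def tourSum {I : Finset V} (f : Sym2 V → ℝ) (X : ℕ → Ω → SuperVertex I) (k : ℕ) (ω : Ω) : ℝ :=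
  ∑ t ∈ Finset.Ico (visitTime X k ω + 1) (visitTime X (k + 1) ω),
    superFun I f (X (t - 1) ω) (X t ω)

/-- The estimator of `μ(G)` from the first `m` tours. -/
def tourEstimator (G : SimpleGraph V) [DecidableRel G.Adj] {I : Finset V} (f : Sym2 V → ℝ)
    (X : ℕ → Ω → SuperVertex I) (m : ℕ) (ω : Ω) : ℝ :=
  (superDegree G I none : ℝ) / (2 * (m : ℝ)) * ∑ k ∈ Finset.range m, tourSum f X k ω
    + seedTotal G I f

/-- The `h`-th batch estimate (batches are numbered from `0`), which averages over the
`⌊√m⌋` consecutive tours `h⌊√m⌋, …, (h+1)⌊√m⌋ - 1`. -/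
def batchEstimate (G : SimpleGraph V) [DecidableRel G.Adj] {I : Finset V} (f : Sym2 V → ℝ)
    (X : ℕ → Ω → SuperVertex I) (m h : ℕ) (ω : Ω) : ℝ :=
  (superDegree G I none : ℝ) / (2 * (m.sqrt : ℝ)) *
      ∑ k ∈ Finset.Ico (h * m.sqrt) ((h + 1) * m.sqrt), tourSum f X k ω
    + seedTotal G I f

end Walk

section Bayes

/-- Density of the inverse-gamma distribution with shape `a` and scale `b`. -/
def invGammaPDF (a b s : ℝ) : ℝ :=
  if 0 < s then b ^ a / Real.Gamma a * s ^ (-a - 1) * Real.exp (-b / s) else 0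

/-- The prior of the pair `(μ, σ²)`: `σ²` is inverse-gamma `(ν₀/2, ν₀σ₀²/2)`, and given `σ²`
the mean `μ` is normal with mean `μ₀` and variance `σ²/m₀`. -/
def normalInvGammaPrior (μ₀ m₀ ν₀ σ₀ : ℝ) : Measure (ℝ × ℝ) :=
  (volume : Measure (ℝ × ℝ)).withDensity fun θ =>
    ENNReal.ofReal (invGammaPDF (ν₀ / 2) (ν₀ * σ₀ ^ 2 / 2) θ.2
      * gaussianPDFReal μ₀ (θ.2 / m₀).toNNReal θ.1)

/-- The likelihood of `θ = (μ, σ²)` for observations `y` that are i.i.d. normal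
with mean `μ` and variance `σ²`. -/
def normalLikelihood {n : ℕ} (y : Fin n → ℝ) (θ : ℝ × ℝ) : ℝ≥0∞ :=
  ∏ h, gaussianPDF θ.1 θ.2.toNNReal (y h)

/-- Bayes' formula: the posterior is proportional to likelihood times prior. -/
def bayesPosterior {Θ : Type*} [MeasurableSpace Θ] (prior : Measure Θ) (lik : Θ → ℝ≥0∞) :
    Measure Θ :=
  (∫⁻ θ, lik θ ∂prior)⁻¹ • prior.withDensity lik

/-- The marginal posterior of `μ` given the observations `y`. -/
def marginalPosterior (μ₀ m₀ ν₀ σ₀ : ℝ) {n : ℕ} (y : Fin n → ℝ) : Measure ℝ :=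
  (bayesPosterior (normalInvGammaPrior μ₀ m₀ ν₀ σ₀) (normalLikelihood y)).map Prod.fst

/-- Density of the non-standardized Student distribution with `ν` degrees of freedom, location
`loc` and scale `sc`. -/
def studentPDF (ν loc sc x : ℝ) : ℝ :=
  Real.Gamma ((ν + 1) / 2) / (Real.Gamma (ν / 2) * sc * Real.sqrt (Real.pi * ν))
    * (1 + (x - loc) ^ 2 / (sc ^ 2 * ν)) ^ (-((ν + 1) / 2))

/-- The non-standardized Student distribution. -/
def studentMeasure (ν loc sc : ℝ) : Measure ℝ :=
  volume.withDensity fun x => ENNReal.ofReal (studentPDF ν loc sc x)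

/-- The location parameter, from the overall estimate `muHat` and the number `n` of batches. -/
def postLocation (μ₀ m₀ : ℝ) (n : ℕ) (muHat : ℝ) : ℝ :=
  (m₀ * μ₀ + n * muHat) / (m₀ + n)

/-- The scale parameter, from the overall estimate `muHat` and the batch estimates `y`. -/
def postScale (μ₀ m₀ ν₀ σ₀ : ℝ) {n : ℕ} (muHat : ℝ) (y : Fin n → ℝ) : ℝ :=
  Real.sqrt ((ν₀ * σ₀ ^ 2 + ∑ h, (y h - muHat) ^ 2 + m₀ * n * (muHat - μ₀) ^ 2 / (m₀ + n))
    / ((ν₀ + n) * (m₀ + n)))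

/-- The total variation distance between `p m` and `q m` tends to `0` as `m → ∞`. -/
def TendstoTotalVariation (p q : ℕ → Measure ℝ) : Prop :=
  ∀ ε > 0, ∀ᶠ m in atTop, ∀ A, MeasurableSet A → |(p m).real A - (q m).real A| ≤ ε

end Bayes

end CrawlTours

end

noncomputable section

namespace CrawlTours

/-! ### The Student density as a normal mixture over the variance. -/

section Student

/-! At each visit to the super-node the walk starts afresh, so the tours are i.i.d. words
(`prod_measure_tourWord_le`, `iIndepFun_tourSum`). Let Q be the transition matrix on the nodes
outside I and π(u) = d_u/d_S. Reversibility gives π - πQ = p(S, ·), so the probability of being at v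
at time t+1 without having returned is (πQ^t - πQ^{t+1})(v). Summed over t this telescopes to
d_v/d_S expected visits per tour (`hasSum_measureReal_alive`), whence E W_1 = 2(μ(G) - c)/d_S
(`integral_tourSum`). Since I meets every component, πQ^t tends to 0; it therefore halves over some
fixed number of steps and decays geometrically, so the tour length, and with it W_1, has exponential
moments. Parts 1 and 2 are then statements about disjoint blocks of i.i.d. variables: the central
limit theorem for one block, and independence to pass to r blocks.

For part 3, completing the square and integrating out the variance shows that the posterior is
exactly a Student law (`marginalPosterior_eq_studentMeasure`), but with the mean of the batches,
which uses the first m'^2 tours, where the theorem has the estimator from all m tours. The scale can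
be as small as order 1/m', so these two numbers must differ by o(1/m') almost surely, which is more
than the law of large numbers gives. The surplus consists of at most 2m' tours; a Chernoff bound
makes its centred sum exceed εm' with probability at most e^{-cm'}, which is summable over m, and
Borel-Cantelli applies (`ae_tendsto_sum_Ico_div`).

Consequently the two locations differ by o(scale), and the ratio of the scales tends to 1 because
the prior keeps the sum of squares above ν₀σ₀². Two Student laws with the same ν are compared in
total variation through a third, wider one, whose density dominates both up to a factor close to 1,
uniformly in ν ≥ 1 (`studentPDF_le_mul`). -/

theorem lintegral_rpow_mul_exp_neg_div {p b : ℝ} (hp : 0 < p) (hb : 0 < b) :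
    ∫⁻ s in Set.Ioi (0 : ℝ), ENNReal.ofReal (s ^ (-p - 1) * Real.exp (-b / s)) =
      ENNReal.ofReal (Real.Gamma p * b ^ (-p)) := by
  set g : ℝ → ℝ := fun t => t ^ (p - 1) * Real.exp (-(b * t)) with hg
  -- The substitution t = 1/s, with its Jacobian s^(-2), leads to the Gamma integral of `g`.
  have hsub : ∀ s ∈ Set.Ioi (0 : ℝ), s ^ (-p - 1) * Real.exp (-b / s) =
      (|(-1 : ℝ)| * s ^ ((-1 : ℝ) - 1)) • g (s ^ (-1 : ℝ)) := by
    intro s hs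
    have hs : 0 < s := hs
    simp only [hg, smul_eq_mul, abs_neg, abs_one, one_mul]
    rw [← Real.rpow_mul hs.le, ← mul_assoc, ← Real.rpow_add hs, Real.rpow_neg_one]
    congr 2
    · ring
    · rw [neg_div, div_eq_mul_inv]
  have hgi : IntegrableOn g (Set.Ioi 0) := by
    have := integrableOn_rpow_mul_exp_neg_mul_rpow (s := p - 1) (p := 1) (b := b)
      (by linarith) one_pos hb
    simpa [hg, neg_mul] using this
  have hi : IntegrableOn (fun s : ℝ => (|(-1 : ℝ)| * s ^ ((-1 : ℝ) - 1)) • g (s ^ (-1 : ℝ)))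
      (Set.Ioi 0) := (integrableOn_Ioi_comp_rpow_iff g (by norm_num)).2 hgi
  rw [setLIntegral_congr_fun measurableSet_Ioi (fun s hs => by rw [hsub s hs]),
    ← ofReal_integral_eq_lintegral_ofReal hi]
  · rw [integral_comp_rpow_Ioi g (by norm_num), hg, Real.integral_rpow_mul_exp_neg_mul_Ioi hp hb,
      mul_comm, one_div, Real.inv_rpow hb.le, Real.rpow_neg hb.le]
  · filter_upwards [ae_restrict_mem measurableSet_Ioi] with s hs
    rw [← hsub s hs]
    have hs : 0 < s := hs
    simp only [Pi.zero_apply]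
    positivity

theorem lintegral_exp_neg_sq_div {s : ℝ} (hs : 0 < s) (a : ℝ) :
    ∫⁻ x : ℝ, ENNReal.ofReal (Real.exp (-(x - a) ^ 2 / s)) =
      ENNReal.ofReal (Real.sqrt Real.pi * s ^ (1 / 2 : ℝ)) := by
  have hv : (s / 2).toNNReal ≠ 0 := by simpa using hs
  have h : ∀ x : ℝ, ENNReal.ofReal (Real.exp (-(x - a) ^ 2 / s)) =
      ENNReal.ofReal (Real.sqrt (Real.pi * s)) * gaussianPDF a (s / 2).toNNReal x := by
    intro x
    rw [gaussianPDF, ← ENNReal.ofReal_mul (by positivity), gaussianPDFReal,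
      Real.coe_toNNReal _ (by positivity)]
    have : 2 * Real.pi * (s / 2) = Real.pi * s := by ring
    rw [this, ← mul_assoc, mul_inv_cancel₀ (by positivity), one_mul]
    congr 3
    ring
  simp_rw [h]
  rw [lintegral_const_mul _ (by fun_prop), lintegral_gaussianPDF_eq_one _ hv, mul_one,
    Real.sqrt_mul Real.pi_nonneg, Real.sqrt_eq_rpow s]

/-- The integrand is itself an inverse-gamma integral over a variance s. After exchanging the
integrals, the inner one is Gaussian and costs a factor s^(1/2), which lowers p by 1/2. -/
theorem lintegral_rpow_add_sq {p b : ℝ} (hp : 1 / 2 < p) (hb : 0 < b) (a : ℝ) :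
    ∫⁻ x : ℝ, ENNReal.ofReal (Real.Gamma p * (b + (x - a) ^ 2) ^ (-p)) =
      ENNReal.ofReal (Real.sqrt Real.pi * (Real.Gamma (p - 1 / 2) * b ^ (-(p - 1 / 2)))) := by
  have h : ∀ x : ℝ, ENNReal.ofReal (Real.Gamma p * (b + (x - a) ^ 2) ^ (-p)) =
      ∫⁻ s in Set.Ioi (0 : ℝ),
        ENNReal.ofReal (s ^ (-p - 1) * Real.exp (-(b + (x - a) ^ 2) / s)) := fun x =>
    (lintegral_rpow_mul_exp_neg_div (by linarith) (by positivity)).symm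
  simp_rw [h]
  rw [lintegral_lintegral_swap]
  · rw [ENNReal.ofReal_mul (by positivity), ← lintegral_rpow_mul_exp_neg_div (by linarith) hb,
      ← lintegral_const_mul _ (by fun_prop)]
    refine setLIntegral_congr_fun measurableSet_Ioi fun s hs => ?_
    have hs : 0 < s := hs
    have : ∀ x : ℝ, ENNReal.ofReal (s ^ (-p - 1) * Real.exp (-(b + (x - a) ^ 2) / s)) =
        ENNReal.ofReal (s ^ (-p - 1) * Real.exp (-b / s)) *
          ENNReal.ofReal (Real.exp (-(x - a) ^ 2 / s)) := by
      intro x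
      rw [← ENNReal.ofReal_mul (by positivity), mul_assoc, ← Real.exp_add]
      congr 3
      ring
    simp_rw [this]
    rw [lintegral_const_mul _ (by fun_prop), lintegral_exp_neg_sq_div hs,
      ← ENNReal.ofReal_mul (by positivity), ← ENNReal.ofReal_mul (by positivity)]
    congr 1
    have : s ^ (-(p - 1 / 2) - 1) = s ^ (-p - 1) * s ^ (1 / 2 : ℝ) := by
      rw [← Real.rpow_add hs]; congr 1; ring
    rw [this]
    ring
  · exact Measurable.aemeasurable (by fun_prop)

theorem measurable_studentPDF (ν loc sc : ℝ) : Measurable (studentPDF ν loc sc) := by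
  unfold studentPDF
  fun_prop

theorem lintegral_studentPDF {ν sc : ℝ} (hν : 0 < ν) (hsc : 0 < sc) (loc : ℝ) :
    ∫⁻ x, ENNReal.ofReal (studentPDF ν loc sc x) = 1 := by
  have hG := Real.Gamma_pos_of_pos (show 0 < (ν + 1) / 2 by linarith)
  have hG' := Real.Gamma_pos_of_pos (show 0 < ν / 2 by linarith)
  have hb : 0 < sc ^ 2 * ν := by positivity
  set c : ℝ := (sc ^ 2 * ν) ^ ((ν + 1) / 2) / (Real.Gamma (ν / 2) * sc * Real.sqrt (Real.pi * ν))
    with hc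
  have h : ∀ x, ENNReal.ofReal (studentPDF ν loc sc x) = ENNReal.ofReal c *
      ENNReal.ofReal (Real.Gamma ((ν + 1) / 2) *
        (sc ^ 2 * ν + (x - loc) ^ 2) ^ (-((ν + 1) / 2))) := by
    intro x
    rw [← ENNReal.ofReal_mul (by positivity), studentPDF, hc]
    congr 1
    have : sc ^ 2 * ν + (x - loc) ^ 2 = sc ^ 2 * ν * (1 + (x - loc) ^ 2 / (sc ^ 2 * ν)) := by
      field_simp
    rw [this, Real.mul_rpow hb.le (by positivity), Real.rpow_neg hb.le]
    have : (sc ^ 2 * ν) ^ ((ν + 1) / 2) ≠ 0 := by positivity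
    field_simp
  simp_rw [h]
  rw [lintegral_const_mul _ (by fun_prop), lintegral_rpow_add_sq (by linarith) hb,
    ← ENNReal.ofReal_mul (by positivity), hc]
  have e1 : (ν + 1) / 2 - 1 / 2 = ν / 2 := by ring
  have e2 : (sc ^ 2 * ν) ^ ((ν + 1) / 2) = (sc ^ 2 * ν) ^ (ν / 2) * (sc * Real.sqrt ν) := by
    have : (ν + 1) / 2 = ν / 2 + 1 / 2 := by ring
    rw [this, Real.rpow_add hb, ← Real.sqrt_eq_rpow, Real.sqrt_mul (by positivity),
      Real.sqrt_sq hsc.le]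
  rw [e1, e2, Real.rpow_neg hb.le, Real.sqrt_mul Real.pi_nonneg]
  have : (sc ^ 2 * ν) ^ (ν / 2) ≠ 0 := by positivity
  rw [← ENNReal.ofReal_one]
  congr 1
  field_simp

theorem isProbabilityMeasure_studentMeasure {ν sc : ℝ} (hν : 0 < ν) (hsc : 0 < sc) (loc : ℝ) :
    IsProbabilityMeasure (studentMeasure ν loc sc) :=
  ⟨by rw [studentMeasure, withDensity_apply _ MeasurableSet.univ, Measure.restrict_univ,
    lintegral_studentPDF hν hsc]⟩

end Student

/-! ### Total variation distance of Student laws. -/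

section TotalVariation

/-- Domination bounds p(A) - q(A) by (C - 1)q(A); the opposite inequality is the same bound for the
complement, as both masses are one. -/
theorem abs_measureReal_sub_le_of_le_smul {α : Type*} [MeasurableSpace α] {p q : Measure α}
    [IsProbabilityMeasure p] [IsProbabilityMeasure q] {C : ℝ} (hC : 0 ≤ C)
    (h : p ≤ ENNReal.ofReal C • q) {A : Set α} (hA : MeasurableSet A) :
    |p.real A - q.real A| ≤ C - 1 := by
  have key : ∀ B, p.real B ≤ C * q.real B := by
    intro B
    have := ENNReal.toReal_mono
      (by rw [Measure.smul_apply, smul_eq_mul]; finiteness) (h B)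
    simpa [Measure.real, ENNReal.toReal_mul, hC] using this
  have h1 := key A
  have h2 := key Aᶜ
  rw [probReal_compl_eq_one_sub hA, probReal_compl_eq_one_sub hA] at h2
  have h3 : q.real A ≤ 1 := measureReal_le_one
  have h4 : 0 ≤ q.real A := measureReal_nonneg
  have h5 := key Set.univ
  simp only [probReal_univ, mul_one] at h5
  rw [abs_le]
  constructor <;> nlinarith

/-- Widening the scale absorbs a shift of the location, by the weighted inequality (u + v)² ≤ (1 +
η)u² + (1 + 1/η)v². The factor does not involve ν, which matters because ν grows with the number of
batches. -/
theorem studentPDF_le_mul {ν a₁ a₂ s₁ s' η : ℝ} (hν : 1 ≤ ν) (hs₁ : 0 < s₁) (hη : 0 < η)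
    (hs' : 0 < s') (h : (1 + η) * s₁ ^ 2 ≤ s' ^ 2) (x : ℝ) :
    studentPDF ν a₁ s₁ x ≤
      s' / s₁ * Real.exp ((a₁ - a₂) ^ 2 / (η * s₁ ^ 2)) * studentPDF ν a₂ s' x := by
  have hG := Real.Gamma_pos_of_pos (show 0 < (ν + 1) / 2 by linarith)
  have hG' := Real.Gamma_pos_of_pos (show 0 < ν / 2 by linarith)
  have hν0 : 0 < ν := by linarith
  set κ := (a₁ - a₂) ^ 2 / (η * s₁ ^ 2) with hκ
  have hκ0 : 0 ≤ κ := by positivity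
  have hsq : (x - a₂) ^ 2 ≤ (1 + η) * (x - a₁) ^ 2 + (1 + 1 / η) * (a₁ - a₂) ^ 2 := by
    have : (1 + η) * (x - a₁) ^ 2 + (1 + 1 / η) * (a₁ - a₂) ^ 2 - (x - a₂) ^ 2 =
        (η * (x - a₁) - (a₁ - a₂)) ^ 2 / η := by
      field_simp; ring
    have : 0 ≤ (η * (x - a₁) - (a₁ - a₂)) ^ 2 / η := by positivity
    linarith
  have hbase : 1 + (x - a₂) ^ 2 / (s' ^ 2 * ν) ≤
      (1 + (x - a₁) ^ 2 / (s₁ ^ 2 * ν)) * (1 + κ / ν) := by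
    have h1 : (x - a₂) ^ 2 / (s' ^ 2 * ν) ≤ (x - a₂) ^ 2 / ((1 + η) * s₁ ^ 2 * ν) := by
      gcongr
    have h2 : (x - a₂) ^ 2 / ((1 + η) * s₁ ^ 2 * ν) ≤
        ((1 + η) * (x - a₁) ^ 2 + (1 + 1 / η) * (a₁ - a₂) ^ 2) / ((1 + η) * s₁ ^ 2 * ν) := by
      gcongr
    have h3 : ((1 + η) * (x - a₁) ^ 2 + (1 + 1 / η) * (a₁ - a₂) ^ 2) / ((1 + η) * s₁ ^ 2 * ν) =
        (x - a₁) ^ 2 / (s₁ ^ 2 * ν) + κ / ν := by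
      rw [hκ]; field_simp; ring
    have h4 : 0 ≤ (x - a₁) ^ 2 / (s₁ ^ 2 * ν) * (κ / ν) := by positivity
    nlinarith
  -- The exponent κ(ν + 1)/(2ν) is at most κ exactly because ν ≥ 1.
  have hexp : (1 + κ / ν) ^ ((ν + 1) / 2) ≤ Real.exp κ := by
    calc (1 + κ / ν) ^ ((ν + 1) / 2) ≤ Real.exp (κ / ν) ^ ((ν + 1) / 2) := by
          gcongr
          linarith [Real.add_one_le_exp (κ / ν)]
      _ = Real.exp (κ / ν * ((ν + 1) / 2)) := (Real.exp_mul _ _).symm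
      _ ≤ Real.exp κ := by
          gcongr
          rw [div_mul_eq_mul_div, div_le_iff₀ hν0]
          nlinarith
  have hpow : (1 + (x - a₁) ^ 2 / (s₁ ^ 2 * ν)) ^ (-((ν + 1) / 2)) ≤
      Real.exp κ * (1 + (x - a₂) ^ 2 / (s' ^ 2 * ν)) ^ (-((ν + 1) / 2)) := by
    rw [Real.rpow_neg (by positivity), Real.rpow_neg (by positivity), ← div_eq_mul_inv,
      inv_eq_one_div, div_le_div_iff₀ (by positivity) (by positivity), one_mul]
    calc (1 + (x - a₂) ^ 2 / (s' ^ 2 * ν)) ^ ((ν + 1) / 2)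
        ≤ ((1 + (x - a₁) ^ 2 / (s₁ ^ 2 * ν)) * (1 + κ / ν)) ^ ((ν + 1) / 2) := by gcongr
      _ = (1 + κ / ν) ^ ((ν + 1) / 2) * (1 + (x - a₁) ^ 2 / (s₁ ^ 2 * ν)) ^ ((ν + 1) / 2) := by
          rw [Real.mul_rpow (by positivity) (by positivity), mul_comm]
      _ ≤ _ := by gcongr
  unfold studentPDF
  calc _ ≤ Real.Gamma ((ν + 1) / 2) / (Real.Gamma (ν / 2) * s₁ * Real.sqrt (Real.pi * ν)) *
        (Real.exp κ * (1 + (x - a₂) ^ 2 / (s' ^ 2 * ν)) ^ (-((ν + 1) / 2))) := by gcongr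
    _ = _ := by field_simp

theorem studentMeasure_le_smul {ν a₁ a₂ s₁ s' η : ℝ} (hν : 1 ≤ ν) (hs₁ : 0 < s₁) (hη : 0 < η)
    (hs' : 0 < s') (h : (1 + η) * s₁ ^ 2 ≤ s' ^ 2) :
    studentMeasure ν a₁ s₁ ≤
      ENNReal.ofReal (s' / s₁ * Real.exp ((a₁ - a₂) ^ 2 / (η * s₁ ^ 2))) •
        studentMeasure ν a₂ s' := by
  unfold studentMeasure
  rw [← withDensity_smul _ (measurable_studentPDF _ _ _).ennreal_ofReal]
  refine withDensity_mono (ae_of_all _ fun x => ?_)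
  simp only [Pi.smul_apply, smul_eq_mul]
  rw [← ENNReal.ofReal_mul (by positivity)]
  exact ENNReal.ofReal_le_ofReal (studentPDF_le_mul hν hs₁ hη hs' h x)

/-- Student distributions with the same, not too small, number of degrees of freedom are close in
total variation when their locations are close on the scale of the scale parameters, and the ratio
of these is close to one. -/
theorem tendstoTotalVariation_studentMeasure {ν a b s t : ℕ → ℝ}
    (hν : ∀ᶠ m in atTop, 1 ≤ ν m) (hs : ∀ᶠ m in atTop, 0 < s m) (ht : ∀ᶠ m in atTop, 0 < t m)
    (hab : Tendsto (fun m => (a m - b m) / s m) atTop (𝓝 0))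
    (hst : Tendsto (fun m => s m / t m) atTop (𝓝 1)) :
    TendstoTotalVariation (fun m => studentMeasure (ν m) (a m) (s m))
      (fun m => studentMeasure (ν m) (b m) (t m)) := by
  intro ε hε
  -- One factor 1 + η will come from the widening, one from the ratio of the scales, and e^η from
  -- the shift.
  obtain ⟨η, hη, hη'⟩ : ∃ η : ℝ, 0 < η ∧ (1 + η) * (1 + η) * Real.exp η ≤ 1 + ε / 2 := by
    have hc : Tendsto (fun η : ℝ => (1 + η) * (1 + η) * Real.exp η) (𝓝[>] 0) (𝓝 1) := by
      have : ContinuousAt (fun η : ℝ => (1 + η) * (1 + η) * Real.exp η) 0 := by fun_prop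
      have := this.tendsto.mono_left (nhdsWithin_le_nhds (s := Set.Ioi 0))
      simpa using this
    obtain ⟨η, h1, h2⟩ := ((hc.eventually (Iio_mem_nhds (show (1 : ℝ) < 1 + ε / 2 by linarith))).and
      self_mem_nhdsWithin).exists
    exact ⟨η, h2, h1.le⟩
  have hab' : ∀ᶠ m in atTop, |(a m - b m) / s m| < η := by
    refine hab.abs.eventually (p := fun x => x < η) (Iio_mem_nhds ?_)
    simpa using hη
  have h1 : ∀ᶠ m in atTop, s m / t m < 1 + η :=
    hst.eventually (Iio_mem_nhds (by linarith))
  have h2 : ∀ᶠ m in atTop, 1 / (1 + η) < s m / t m :=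
    hst.eventually (Ioi_mem_nhds (by rw [div_lt_one (by positivity)]; linarith))
  filter_upwards [hν, hs, ht, hab', h1, h2] with m hν hs ht hab' h1 h2 A hA
  rw [div_lt_iff₀ ht] at h1
  rw [div_lt_div_iff₀ (by positivity) ht] at h2
  -- A common wider scale: both laws are compared with the Student law at `b m` of scale `s'`, at
  -- the cost of ε/2 each.
  set s' := (1 + η) * max (s m) (t m) with hs'
  have hs'0 : 0 < s' := by positivity
  have e1 : (1 + η) * s m ^ 2 ≤ s' ^ 2 := by
    have : s m ≤ max (s m) (t m) := le_max_left _ _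
    rw [hs', mul_pow]
    gcongr
    nlinarith
  have e2 : (1 + η) * t m ^ 2 ≤ s' ^ 2 := by
    have : t m ≤ max (s m) (t m) := le_max_right _ _
    rw [hs', mul_pow]
    gcongr
    nlinarith
  have : 0 < ν m := by linarith
  have := isProbabilityMeasure_studentMeasure this hs (a m)
  have := isProbabilityMeasure_studentMeasure ‹0 < ν m› ht (b m)
  have := isProbabilityMeasure_studentMeasure ‹0 < ν m› hs'0 (b m)
  have b1 := abs_measureReal_sub_le_of_le_smul (by positivity)
    (studentMeasure_le_smul (a₁ := a m) (a₂ := b m) hν hs hη hs'0 e1) hA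
  have b2 := abs_measureReal_sub_le_of_le_smul (by positivity)
    (studentMeasure_le_smul (a₁ := b m) (a₂ := b m) hν ht hη hs'0 e2) hA
  have m1 : max (s m) (t m) ≤ (1 + η) * s m := max_le (by nlinarith) (by linarith)
  have m2 : max (s m) (t m) ≤ (1 + η) * t m := max_le (by linarith) (by nlinarith)
  have r1 : s' / s m ≤ (1 + η) * (1 + η) := by
    rw [div_le_iff₀ hs, hs', mul_assoc]; gcongr
  have r2 : s' / t m ≤ (1 + η) * (1 + η) := by
    rw [div_le_iff₀ ht, hs', mul_assoc]; gcongr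
  have x1 : (a m - b m) ^ 2 / (η * s m ^ 2) ≤ η := by
    rw [abs_div, abs_of_pos hs, div_lt_iff₀ hs] at hab'
    rw [div_le_iff₀ (by positivity), ← sq_abs]
    calc |a m - b m| ^ 2 ≤ (η * s m) ^ 2 := by gcongr
      _ = _ := by ring
  have c1 : s' / s m * Real.exp ((a m - b m) ^ 2 / (η * s m ^ 2)) ≤ 1 + ε / 2 :=
    le_trans (by gcongr) hη'
  have c2 : s' / t m * Real.exp ((b m - b m) ^ 2 / (η * t m ^ 2)) ≤ 1 + ε / 2 := by
    refine le_trans ?_ hη'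
    have : (b m - b m) ^ 2 / (η * t m ^ 2) ≤ η := by simpa using hη.le
    gcongr
  rw [abs_le] at b1 b2 ⊢
  constructor <;> linarith [b1.1, b1.2, b2.1, b2.2]

end TotalVariation

/-! ### Conjugacy: the exact marginal posterior. -/

section Posterior

theorem gaussianPDFReal_eq_rpow (a : ℝ) {c s : ℝ} (hc : 0 < c) (hs : 0 < s) (x : ℝ) :
    gaussianPDFReal a (s / c).toNNReal x =
      (Real.sqrt (2 * Real.pi / c))⁻¹ * s ^ (-(1 / 2 : ℝ)) *
        Real.exp (-(c * (x - a) ^ 2 / 2) / s) := by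
  rw [gaussianPDFReal, Real.coe_toNNReal _ (by positivity)]
  have : 2 * Real.pi * (s / c) = 2 * Real.pi / c * s := by ring
  rw [this, Real.sqrt_mul (by positivity), mul_inv, Real.rpow_neg hs.le, ← Real.sqrt_eq_rpow]
  congr 2
  field_simp

theorem prod_gaussianPDFReal {n : ℕ} (y : Fin n → ℝ) (x : ℝ) {s : ℝ} (hs : 0 < s) :
    ∏ h, gaussianPDFReal x s.toNNReal (y h) =
      (Real.sqrt (2 * Real.pi))⁻¹ ^ n * s ^ (-(n / 2 : ℝ)) *
        Real.exp (-((∑ h, (y h - x) ^ 2) / 2) / s) := by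
  have : ∀ h, gaussianPDFReal x s.toNNReal (y h) = (Real.sqrt (2 * Real.pi))⁻¹ *
      s ^ (-(1 / 2 : ℝ)) * Real.exp (-((y h - x) ^ 2 / 2) / s) := by
    intro h
    simpa using gaussianPDFReal_eq_rpow x one_pos hs (y h)
  simp_rw [this]
  rw [Finset.prod_mul_distrib, Finset.prod_const, Finset.card_univ, Fintype.card_fin, mul_pow,
    ← Real.rpow_mul_natCast hs.le, ← Real.exp_sum, ← Finset.sum_div, Finset.sum_neg_distrib,
    ← Finset.sum_div]
  congr 3
  ring

/-- Sum of squares of the data about the mean `a`, combined with the prior. -/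
def postSquares (μ₀ m₀ ν₀ σ₀ : ℝ) {n : ℕ} (a : ℝ) (y : Fin n → ℝ) : ℝ :=
  ν₀ * σ₀ ^ 2 + ∑ h, (y h - a) ^ 2 + m₀ * n * (a - μ₀) ^ 2 / (m₀ + n)

theorem postSquares_pos {m₀ ν₀ σ₀ : ℝ} (hm₀ : 0 < m₀) (hν₀ : 0 < ν₀) (hσ₀ : 0 < σ₀) (μ₀ : ℝ)
    {n : ℕ} (a : ℝ) (y : Fin n → ℝ) : 0 < postSquares μ₀ m₀ ν₀ σ₀ a y := by
  unfold postSquares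
  have : 0 ≤ ∑ h, (y h - a) ^ 2 := Finset.sum_nonneg fun _ _ => sq_nonneg _
  positivity

theorem postScale_eq (μ₀ m₀ ν₀ σ₀ : ℝ) {n : ℕ} (a : ℝ) (y : Fin n → ℝ) :
    postScale μ₀ m₀ ν₀ σ₀ a y =
      Real.sqrt (postSquares μ₀ m₀ ν₀ σ₀ a y / ((ν₀ + n) * (m₀ + n))) := rfl

theorem sum_sq_sub_eq {n : ℕ} (y : Fin n → ℝ) (hn : n ≠ 0) (x : ℝ) :
    ∑ h, (y h - x) ^ 2 =
      ∑ h, (y h - (∑ h, y h) / n) ^ 2 + n * ((∑ h, y h) / n - x) ^ 2 := by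
  set a := (∑ h, y h) / n with ha
  have hsum : ∑ h, y h = n * a := by
    rw [ha]; field_simp
  have : ∀ h, (y h - x) ^ 2 = (y h - a) ^ 2 + (2 * (a - x) * y h - 2 * (a - x) * a
      + (a - x) ^ 2) := fun h => by ring
  simp_rw [this]
  rw [Finset.sum_add_distrib, Finset.sum_add_distrib, Finset.sum_sub_distrib, ← Finset.mul_sum,
    hsum]
  simp
  ring

/-- The exponents of prior and likelihood form one quadratic polynomial in x. Its leading
coefficient, minimiser and minimum give the posterior precision, location and sum of squares. -/
theorem complete_square {n : ℕ} (y : Fin n → ℝ) (hn : n ≠ 0) {m₀ : ℝ} (hm₀ : 0 < m₀)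
    (μ₀ ν₀ σ₀ x : ℝ) :
    ν₀ * σ₀ ^ 2 + m₀ * (x - μ₀) ^ 2 + ∑ h, (y h - x) ^ 2 =
      postSquares μ₀ m₀ ν₀ σ₀ ((∑ h, y h) / n) y +
        (m₀ + n) * (x - postLocation μ₀ m₀ n ((∑ h, y h) / n)) ^ 2 := by
  rw [sum_sq_sub_eq y hn x, postSquares, postLocation]
  generalize (∑ h, y h) / (n : ℝ) = a
  generalize ∑ h, (y h - a) ^ 2 = b
  have : m₀ + n ≠ 0 := by positivity
  field_simp
  ring

/-- The joint density of the parameters and the data, for data `y`. -/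
def jointDensity (μ₀ m₀ ν₀ σ₀ : ℝ) {n : ℕ} (y : Fin n → ℝ) (θ : ℝ × ℝ) : ℝ≥0∞ :=
  ENNReal.ofReal (invGammaPDF (ν₀ / 2) (ν₀ * σ₀ ^ 2 / 2) θ.2
      * gaussianPDFReal μ₀ (θ.2 / m₀).toNNReal θ.1) * normalLikelihood y θ

theorem measurable_invGammaPDF (a b : ℝ) : Measurable (invGammaPDF a b) := by
  unfold invGammaPDF
  exact Measurable.ite measurableSet_Ioi (by fun_prop) (by fun_prop)

theorem measurable_priorDensity (μ₀ m₀ ν₀ σ₀ : ℝ) : Measurable fun θ : ℝ × ℝ =>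
    ENNReal.ofReal (invGammaPDF (ν₀ / 2) (ν₀ * σ₀ ^ 2 / 2) θ.2
      * gaussianPDFReal μ₀ (θ.2 / m₀).toNNReal θ.1) := by
  have := measurable_invGammaPDF (ν₀ / 2) (ν₀ * σ₀ ^ 2 / 2)
  unfold gaussianPDFReal
  fun_prop

theorem measurable_normalLikelihood {n : ℕ} (y : Fin n → ℝ) : Measurable (normalLikelihood y) := by
  unfold normalLikelihood gaussianPDF gaussianPDFReal
  fun_prop

theorem measurable_jointDensity (μ₀ m₀ ν₀ σ₀ : ℝ) {n : ℕ} (y : Fin n → ℝ) :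
    Measurable (jointDensity μ₀ m₀ ν₀ σ₀ y) :=
  (measurable_priorDensity μ₀ m₀ ν₀ σ₀).mul (measurable_normalLikelihood y)

theorem withDensity_normalLikelihood (μ₀ m₀ ν₀ σ₀ : ℝ) {n : ℕ} (y : Fin n → ℝ) :
    (normalInvGammaPrior μ₀ m₀ ν₀ σ₀).withDensity (normalLikelihood y) =
      (volume : Measure (ℝ × ℝ)).withDensity (jointDensity μ₀ m₀ ν₀ σ₀ y) := by
  rw [normalInvGammaPrior, ← withDensity_mul _ (measurable_priorDensity μ₀ m₀ ν₀ σ₀)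
    (measurable_normalLikelihood y)]
  rfl

theorem jointDensity_of_nonpos (μ₀ m₀ ν₀ σ₀ : ℝ) {n : ℕ} (y : Fin n → ℝ) (x : ℝ) {s : ℝ}
    (hs : s ≤ 0) : jointDensity μ₀ m₀ ν₀ σ₀ y (x, s) = 0 := by
  simp [jointDensity, invGammaPDF, not_lt.2 hs]

theorem jointDensity_of_pos {m₀ ν₀ σ₀ : ℝ} (hm₀ : 0 < m₀) (hν₀ : 0 < ν₀) (hσ₀ : 0 < σ₀) (μ₀ : ℝ)
    {n : ℕ} (hn : n ≠ 0) (y : Fin n → ℝ) (x : ℝ) {s : ℝ} (hs : 0 < s) :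
    jointDensity μ₀ m₀ ν₀ σ₀ y (x, s) =
      ENNReal.ofReal ((ν₀ * σ₀ ^ 2 / 2) ^ (ν₀ / 2) / Real.Gamma (ν₀ / 2) *
          (Real.sqrt (2 * Real.pi / m₀))⁻¹ * (Real.sqrt (2 * Real.pi))⁻¹ ^ n) *
        ENNReal.ofReal (s ^ (-((ν₀ + n + 1) / 2) - 1) *
          Real.exp (-((postSquares μ₀ m₀ ν₀ σ₀ ((∑ h, y h) / n) y +
            (m₀ + n) * (x - postLocation μ₀ m₀ n ((∑ h, y h) / n)) ^ 2) / 2) / s)) := by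
  have hG := Real.Gamma_pos_of_pos (show 0 < ν₀ / 2 by linarith)
  have hlik : normalLikelihood y (x, s) =
      ENNReal.ofReal (∏ h, gaussianPDFReal x s.toNNReal (y h)) := by
    rw [normalLikelihood, ENNReal.ofReal_prod_of_nonneg fun _ _ => gaussianPDFReal_nonneg _ _ _]
    rfl
  rw [jointDensity, hlik, ← ENNReal.ofReal_mul, ← ENNReal.ofReal_mul (by positivity)]
  swap
  · simp only [invGammaPDF, if_pos hs]
    have := gaussianPDFReal_nonneg μ₀ (s / m₀).toNNReal x
    positivity
  congr 1
  simp only [invGammaPDF, if_pos hs]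
  rw [gaussianPDFReal_eq_rpow μ₀ hm₀ hs, prod_gaussianPDFReal y x hs, ← complete_square y hn hm₀]
  -- The power of s collects the inverse-gamma prior, one factor s^(-1/2) from the normal prior, and
  -- n such factors from the likelihood.
  have e1 : s ^ (-((ν₀ + n + 1) / 2) - 1) =
      s ^ (-(ν₀ / 2) - 1) * s ^ (-(1 / 2 : ℝ)) * s ^ (-(n / 2 : ℝ)) := by
    rw [← Real.rpow_add hs, ← Real.rpow_add hs]; congr 1; ring
  have e2 : Real.exp (-((ν₀ * σ₀ ^ 2 + m₀ * (x - μ₀) ^ 2 + ∑ h, (y h - x) ^ 2) / 2) / s) =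
      Real.exp (-(ν₀ * σ₀ ^ 2 / 2) / s) * Real.exp (-(m₀ * (x - μ₀) ^ 2 / 2) / s) *
        Real.exp (-((∑ h, (y h - x) ^ 2) / 2) / s) := by
    rw [← Real.exp_add, ← Real.exp_add]; congr 1; ring
  rw [e1, e2]
  ring

/-- Integrating out the variance from the joint density gives a multiple of a Student density. -/
theorem exists_lintegral_jointDensity {m₀ ν₀ σ₀ : ℝ} (hm₀ : 0 < m₀) (hν₀ : 0 < ν₀) (hσ₀ : 0 < σ₀)
    (μ₀ : ℝ) {n : ℕ} (hn : n ≠ 0) (y : Fin n → ℝ) :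
    ∃ K : ℝ, 0 < K ∧ ∀ x, ∫⁻ s, jointDensity μ₀ m₀ ν₀ σ₀ y (x, s) = ENNReal.ofReal K *
      ENNReal.ofReal (studentPDF (ν₀ + n) (postLocation μ₀ m₀ n ((∑ h, y h) / n))
        (postScale μ₀ m₀ ν₀ σ₀ ((∑ h, y h) / n) y) x) := by
  have hG := Real.Gamma_pos_of_pos (show 0 < ν₀ / 2 by linarith)
  have hp : 0 < (ν₀ + n + 1) / 2 := by positivity
  have hG1 := Real.Gamma_pos_of_pos hp
  have hG2 := Real.Gamma_pos_of_pos (show 0 < (ν₀ + n) / 2 by positivity)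
  set B := postSquares μ₀ m₀ ν₀ σ₀ ((∑ h, y h) / n) y with hBdef
  set a := postLocation μ₀ m₀ n ((∑ h, y h) / n)
  have hB : 0 < B := postSquares_pos hm₀ hν₀ hσ₀ μ₀ _ y
  set K₀ : ℝ := (ν₀ * σ₀ ^ 2 / 2) ^ (ν₀ / 2) / Real.Gamma (ν₀ / 2) *
          (Real.sqrt (2 * Real.pi / m₀))⁻¹ * (Real.sqrt (2 * Real.pi))⁻¹ ^ n with hK₀
  have hK₀' : 0 < K₀ := by positivity
  set sc := postScale μ₀ m₀ ν₀ σ₀ ((∑ h, y h) / n) y with hsc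
  have hsc2 : sc ^ 2 * (ν₀ + n) = B / (m₀ + n) := by
    rw [hsc, postScale_eq, Real.sq_sqrt (by positivity), ← hBdef]
    have : ν₀ + n ≠ 0 := by positivity
    field_simp
  have hsc0 : 0 < sc := by
    rw [hsc, postScale_eq]; positivity
  refine ⟨K₀ * (B / 2) ^ (-((ν₀ + n + 1) / 2)) *
    (Real.Gamma ((ν₀ + n) / 2) * sc * Real.sqrt (Real.pi * (ν₀ + n))), by positivity, fun x => ?_⟩
  have h1 : ∫⁻ s, jointDensity μ₀ m₀ ν₀ σ₀ y (x, s) =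
      ∫⁻ s in Set.Ioi 0, jointDensity μ₀ m₀ ν₀ σ₀ y (x, s) := by
    rw [← lintegral_indicator measurableSet_Ioi]
    congr 1
    ext s
    by_cases hs : 0 < s
    · rw [Set.indicator_of_mem (by exact hs)]
    · rw [Set.indicator_of_notMem (by exact hs),
        jointDensity_of_nonpos _ _ _ _ _ _ (not_lt.1 hs)]
  rw [h1, setLIntegral_congr_fun measurableSet_Ioi fun s hs =>
    jointDensity_of_pos hm₀ hν₀ hσ₀ μ₀ hn y x hs, lintegral_const_mul _ (by fun_prop),
    lintegral_rpow_mul_exp_neg_div hp (by positivity), ← ENNReal.ofReal_mul (by positivity),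
    ← ENNReal.ofReal_mul (by positivity)]
  congr 1
  -- The scale is designed for this factorisation: by `hsc2`, B/(m₀ + n) is the constant sc²ν in the
  -- Student density.
  have e1 : (B + (m₀ + n) * (x - a) ^ 2) / 2 =
      B / 2 * (1 + (x - a) ^ 2 / (sc ^ 2 * (ν₀ + n))) := by
    rw [hsc2]; field_simp
  rw [e1, Real.mul_rpow (by positivity) (by positivity), studentPDF, ← hK₀]
  clear_value K₀
  field_simp

/-- Conjugacy: the marginal posterior of the mean is exactly a Student distribution, located at the
posterior mean that belongs to the sample mean. -/
theorem marginalPosterior_eq_studentMeasure {m₀ ν₀ σ₀ : ℝ} (hm₀ : 0 < m₀) (hν₀ : 0 < ν₀)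
    (hσ₀ : 0 < σ₀) (μ₀ : ℝ) {n : ℕ} (hn : n ≠ 0) (y : Fin n → ℝ) :
    marginalPosterior μ₀ m₀ ν₀ σ₀ y =
      studentMeasure (ν₀ + n) (postLocation μ₀ m₀ n ((∑ h, y h) / n))
        (postScale μ₀ m₀ ν₀ σ₀ ((∑ h, y h) / n) y) := by
  obtain ⟨K, hK, h⟩ := exists_lintegral_jointDensity hm₀ hν₀ hσ₀ μ₀ hn y
  have hsc : 0 < postScale μ₀ m₀ ν₀ σ₀ ((∑ h, y h) / n) y := by
    have := postSquares_pos hm₀ hν₀ hσ₀ μ₀ ((∑ h, y h) / n) y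
    rw [postScale_eq]; positivity
  have hprob := isProbabilityMeasure_studentMeasure (show 0 < ν₀ + n by positivity) hsc
    (postLocation μ₀ m₀ n ((∑ h, y h) / n))
  set q := studentMeasure (ν₀ + n) (postLocation μ₀ m₀ n ((∑ h, y h) / n))
        (postScale μ₀ m₀ ν₀ σ₀ ((∑ h, y h) / n) y) with hq
  have hmeas := measurable_jointDensity μ₀ m₀ ν₀ σ₀ y
  have hmap : ((volume : Measure (ℝ × ℝ)).withDensity (jointDensity μ₀ m₀ ν₀ σ₀ y)).map Prod.fst =
      ENNReal.ofReal K • q := by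
    ext A hA
    rw [Measure.map_apply measurable_fst hA, withDensity_apply _ (measurable_fst hA),
      ← lintegral_indicator (measurable_fst hA), Measure.volume_eq_prod,
      lintegral_prod _ (by exact (hmeas.indicator (measurable_fst hA)).aemeasurable),
      Measure.smul_apply, smul_eq_mul, hq, studentMeasure, withDensity_apply _ hA,
      ← lintegral_const_mul _ (measurable_studentPDF _ _ _).ennreal_ofReal,
      ← lintegral_indicator hA]
    congr 1
    ext x
    by_cases hx : x ∈ A
    · rw [Set.indicator_of_mem hx, ← h x]
      congr 1
      ext s
      simp [Set.indicator, hx]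
    · rw [Set.indicator_of_notMem hx]
      simp [Set.indicator, hx]
  -- The normalising constant needs no evaluation: it is the total mass of K times a probability
  -- measure.
  have hZ : ∫⁻ θ, normalLikelihood y θ ∂(normalInvGammaPrior μ₀ m₀ ν₀ σ₀) = ENNReal.ofReal K := by
    have := congrArg (fun p : Measure ℝ => p Set.univ) hmap
    simp only [Measure.smul_apply, measure_univ, smul_eq_mul, mul_one] at this
    rw [← this, Measure.map_apply measurable_fst MeasurableSet.univ, Set.preimage_univ,
      ← withDensity_normalLikelihood, withDensity_apply _ MeasurableSet.univ,
      Measure.restrict_univ]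
  rw [marginalPosterior, bayesPosterior, hZ, withDensity_normalLikelihood, Measure.map_smul, hmap,
    smul_smul, ENNReal.inv_mul_cancel (by simpa using hK) ENNReal.ofReal_ne_top, one_smul]

end Posterior

/-! ### Block sums of i.i.d. variables and their central limit theorem. -/

section Blocks

variable {Ω : Type*}

/-- The sum of `W` over the `h`-th block of length `n`. -/
def blockSum (W : ℕ → Ω → ℝ) (n h : ℕ) (ω : Ω) : ℝ :=
  ∑ k ∈ Finset.Ico (h * n) ((h + 1) * n), W k ω

theorem blockSum_eq (W : ℕ → Ω → ℝ) (n h : ℕ) (ω : Ω) :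
    blockSum W n h ω = ∑ j : Fin n, W (h * n + j) ω := by
  rw [blockSum, Finset.sum_Ico_eq_sum_range, Fin.sum_univ_eq_sum_range (fun j => W (h * n + j) ω)]
  congr 2
  rw [add_mul, one_mul, Nat.add_sub_cancel_left]

variable [MeasurableSpace Ω] {P : Measure Ω}

/-- Independent random variables indexed by pairs form independent families. -/
theorem iIndepFun_curry {ι κ : Type*} {E : Type*} [MeasurableSpace E] {Z : ι → κ → Ω → E}
    (hZ : ∀ i j, Measurable (Z i j))
    (h : iIndepFun (fun (p : (_ : ι) × κ) ω => Z p.1 p.2 ω) P) :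
    iIndepFun (fun i ω j => Z i j ω) P := by
  have := h.isProbabilityMeasure
  have : ∀ i j, IsProbabilityMeasure (P.map (Z i j)) :=
    fun i j => Measure.isProbabilityMeasure_map (hZ i j).aemeasurable
  have h2 : ∀ i, iIndepFun (Z i) P := fun i =>
    h.precomp (g := fun j => (⟨i, j⟩ : (_ : ι) × κ)) fun a b hab => by simpa using hab
  have hcomp : (MeasurableEquiv.piCurry fun (_ : ι) (_ : κ) => E) ∘
      (fun ω (p : (_ : ι) × κ) => Z p.1 p.2 ω) = fun ω i j => Z i j ω := by
    ext; simp [Sigma.curry]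
  rw [iIndepFun_iff_map_fun_eq_infinitePi_map (by fun_prop), ← hcomp,
    ← Measure.map_map (by fun_prop) (by fun_prop),
    (iIndepFun_iff_map_fun_eq_infinitePi_map (by fun_prop)).1 h,
    Measure.infinitePi_map_piCurry (fun i j => P.map (Z i j))]
  congr 1
  ext1 i
  rw [(iIndepFun_iff_map_fun_eq_infinitePi_map (by fun_prop)).1 (h2 i)]

variable {W : ℕ → Ω → ℝ}

theorem measurable_blockSum (hW : ∀ k, Measurable (W k)) (n h : ℕ) :
    Measurable (blockSum W n h) :=
  Finset.measurable_sum _ fun k _ => hW k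

theorem iIndepFun_blockSum (hW : ∀ k, Measurable (W k)) (hind : iIndepFun W P) (n : ℕ) :
    iIndepFun (blockSum W n) P := by
  have h1 : iIndepFun (fun (p : (_ : ℕ) × Fin n) ω => W (p.1 * n + p.2) ω) P := by
    refine hind.precomp (g := fun p : (_ : ℕ) × Fin n => p.1 * n + p.2) ?_
    -- Injectivity of (h, j) ↦ hn + j is uniqueness of quotient and remainder; n > 0 because `Fin n`
    -- is inhabited here.
    rintro ⟨a, i⟩ ⟨b, j⟩ hab
    have hab : a * n + i = b * n + j := hab
    have hn : 0 < n := i.pos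
    have e1 := congrArg (· / n) hab
    have e2 := congrArg (· % n) hab
    simp only [Nat.mul_add_mod', Nat.mod_eq_of_lt i.2, Nat.mod_eq_of_lt j.2] at e2
    simp only [mul_comm _ n, Nat.mul_add_div hn, Nat.div_eq_of_lt i.2, Nat.div_eq_of_lt j.2,
      add_zero] at e1
    subst e1
    simp [Fin.ext_iff, e2]
  have h2 := iIndepFun_curry (Z := fun h (j : Fin n) ω => W (h * n + j) ω)
    (fun h j => hW _) h1
  have h3 := h2.comp (fun _ v => ∑ j, v j) (fun _ => by fun_prop)
  convert! h3 using 2 with h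
  ext ω
  exact blockSum_eq W n h ω

theorem identDistrib_blockSum (hind : iIndepFun W P)
    (hid : ∀ k, IdentDistrib (W k) (W 0) P P) (n h : ℕ) :
    IdentDistrib (blockSum W n h) (fun ω => ∑ k ∈ Finset.range n, W k ω) P P := by
  have h1 : iIndepFun (fun (j : Fin n) ω => W (h * n + j) ω) P :=
    hind.precomp (g := fun j : Fin n => h * n + j) fun a b hab => by
      simpa [Fin.ext_iff] using hab
  have h2 : iIndepFun (fun (j : Fin n) ω => W j ω) P :=
    hind.precomp (g := fun j : Fin n => (j : ℕ)) Fin.val_injective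
  have h3 := (IdentDistrib.pi (fun j : Fin n => (hid (h * n + j)).trans (hid j).symm) h1 h2).comp
    (u := fun v : Fin n → ℝ => ∑ j, v j) (by fun_prop)
  convert! h3 using 1
  · ext ω
    exact blockSum_eq W n h ω
  · ext ω
    exact (Fin.sum_univ_eq_sum_range (fun j => W j ω) n).symm

theorem memLp_blockSum (hid : ∀ k, IdentDistrib (W k) (W 0) P P) (hL : MemLp (W 0) 2 P)
    (n h : ℕ) : MemLp (blockSum W n h) 2 P :=
  memLp_finsetSum _ fun k _ => (hid k).memLp_iff.2 hL

theorem integral_blockSum [IsProbabilityMeasure P] (hid : ∀ k, IdentDistrib (W k) (W 0) P P)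
    (hL : MemLp (W 0) 2 P) (n h : ℕ) :
    ∫ ω, blockSum W n h ω ∂P = n * ∫ ω, W 0 ω ∂P := by
  unfold blockSum
  rw [integral_finsetSum _ fun k _ => ((hid k).memLp_iff.2 hL).integrable (by norm_num)]
  rw [Finset.sum_congr rfl fun k _ => (hid k).integral_eq]
  simp [add_mul]

theorem variance_blockSum (hind : iIndepFun W P)
    (hid : ∀ k, IdentDistrib (W k) (W 0) P P)
    (hL : MemLp (W 0) 2 P) (n h : ℕ) :
    variance (blockSum W n h) P = n * variance (W 0) P := by
  have : blockSum W n h = ∑ k ∈ Finset.Ico (h * n) ((h + 1) * n), W k := by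
    ext ω; simp [blockSum]
  rw [this, IndepFun.variance_sum (fun k _ => (hid k).memLp_iff.2 hL)
    fun i _ j _ hij => hind.indepFun hij, Finset.sum_congr rfl fun k _ => (hid k).variance_eq]
  simp [add_mul]

theorem tendsto_natSqrt : Tendsto Nat.sqrt atTop atTop :=
  tendsto_atTop_atTop.2 fun b => ⟨b * b, fun _ h => Nat.le_sqrt.2 h⟩

/-- Finitely many centred and rescaled block sums, over blocks of length `⌊√m⌋`, tend jointly to
independent normal variables. -/
theorem tendstoInDistribution_blockSum [IsProbabilityMeasure P] (hW : ∀ k, Measurable (W k))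
    (hind : iIndepFun W P) (hid : ∀ k, IdentDistrib (W k) (W 0) P P) (hL : MemLp (W 0) 2 P)
    (r : ℕ) :
    TendstoInDistribution
      (fun (m : ℕ) (ω : Ω) (h : Fin r) =>
        (Real.sqrt (m.sqrt : ℝ))⁻¹ * (blockSum W m.sqrt h ω - m.sqrt * P[W 0]))
      atTop (fun y : Fin r → ℝ => y) (fun _ => P)
      (Measure.pi fun _ : Fin r => gaussianReal 0 (variance (W 0) P).toNNReal) := by
  set v := (variance (W 0) P).toNNReal
  have clt := tendstoInDistribution_inv_sqrt_mul_sum_sub (Y := fun x : ℝ => x)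
    (P' := gaussianReal 0 v) ⟨by fun_prop, by simp [v]⟩ hL hind hid
  have hmeas : ∀ (n : ℕ) (h : ℕ), Measurable fun ω =>
      (Real.sqrt (n : ℝ))⁻¹ * (blockSum W n h ω - n * P[W 0]) := fun n h =>
    ((measurable_blockSum hW n h).sub_const _).const_mul _
  have hmeasv : ∀ n : ℕ, Measurable fun ω (h : Fin r) =>
      (Real.sqrt (n : ℝ))⁻¹ * (blockSum W n h ω - n * P[W 0]) := fun n =>
    measurable_pi_iff.2 fun h => hmeas n h
  -- The joint law is a power of the law of a single block, so weak convergence of that one law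
  -- along n = ⌊√m⌋ and weak continuity of finite products give the joint limit.
  have hlaw : ∀ n : ℕ, P.map (fun ω (h : Fin r) =>
      (Real.sqrt (n : ℝ))⁻¹ * (blockSum W n h ω - n * P[W 0])) =
      Measure.pi fun _ : Fin r => P.map fun ω =>
        (Real.sqrt (n : ℝ))⁻¹ * (∑ k ∈ Finset.range n, W k ω - n * P[W 0]) := by
    intro n
    have i1 : iIndepFun (fun (h : Fin r) ω => blockSum W n h ω) P :=
      (iIndepFun_blockSum hW hind n).precomp (g := fun h : Fin r => (h : ℕ)) Fin.val_injective
    have i2 : iIndepFun (fun (h : Fin r) ω =>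
        (Real.sqrt (n : ℝ))⁻¹ * (blockSum W n h ω - n * P[W 0])) P :=
      i1.comp (fun _ (x : ℝ) => (Real.sqrt (n : ℝ))⁻¹ * (x - n * ∫ ω, W 0 ω ∂P))
        (fun _ => by fun_prop)
    rw [(iIndepFun_iff_map_fun_eq_pi_map fun h : Fin r => (hmeas n h).aemeasurable).1 i2]
    congr 1
    ext1 h
    exact ((identDistrib_blockSum hind hid n h).comp
      (u := fun x => (Real.sqrt (n : ℝ))⁻¹ * (x - n * P[W 0])) (by fun_prop)).map_eq
  refine ⟨fun m => (hmeasv m.sqrt).aemeasurable, by fun_prop, ?_⟩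
  have h1 := clt.tendsto.comp tendsto_natSqrt
  have h2 := (ProbabilityMeasure.continuous_pi (α := fun _ : Fin r => ℝ)).continuousAt.tendsto.comp
    (tendsto_pi_nhds.2 fun _ : Fin r => h1)
  have hlim : ProbabilityMeasure.pi (fun _ : Fin r => (⟨(gaussianReal 0 v).map fun x => x,
      Measure.isProbabilityMeasure_map (by fun_prop)⟩ : ProbabilityMeasure ℝ)) =
      ⟨(Measure.pi fun _ : Fin r => gaussianReal 0 v).map fun y => y,
        Measure.isProbabilityMeasure_map (by fun_prop)⟩ := by
    apply Subtype.ext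
    simp only [Measure.map_id']
    rfl
  rw [hlim] at h2
  refine Tendsto.congr (fun m => ?_) h2
  exact Subtype.ext (hlaw m.sqrt).symm

end Blocks

/-! ### Large deviations of the surplus tours beyond the last full square. -/

section Deviations

variable {Ω : Type*} [MeasurableSpace Ω] {P : Measure Ω} [IsProbabilityMeasure P] {U : ℕ → Ω → ℝ}

/-- Exponential bound for the sum of at most `2n` i.i.d. centred variables to exceed `ε n`. -/
theorem exists_measureReal_sum_ge_le (hind : iIndepFun U P)
    (hid : ∀ k, IdentDistrib (U k) (U 0) P P) (h0 : 0 ∈ interior (integrableExpSet (U 0) P))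
    (hmean : P[U 0] = 0) {ε : ℝ} (hε : 0 < ε) :
    ∃ c : ℝ, 0 < c ∧ ∀ (n : ℕ) (s : Finset ℕ), s.card ≤ 2 * n →
      P.real {ω | ε * n ≤ ∑ k ∈ s, U k ω} ≤ Real.exp (-c * n) := by
  have hd := hasDerivAt_mgf h0
  simp only [zero_mul, Real.exp_zero, mul_one, hmean] at hd
  -- For centred variables mgf(l) ≤ 1 + (ε/4)l ≤ e^{εl/4} at some small l > 0. At most 2n factors
  -- cost e^{εln/2} against the gain e^{-εln}, leaving the rate c = lε/2.
  have hlit := hd.isLittleO.def (show 0 < ε / 4 by positivity)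
  have hmem : ∀ᶠ l in 𝓝 (0 : ℝ), l ∈ integrableExpSet (U 0) P := mem_interior_iff_mem_nhds.1 h0
  obtain ⟨l, ⟨hl1, hl2⟩, hl0⟩ : ∃ l : ℝ, (mgf (U 0) P l ≤ 1 + ε / 4 * l ∧
      l ∈ integrableExpSet (U 0) P) ∧ 0 < l := by
    have h1 : ∀ᶠ l in 𝓝[>] (0 : ℝ), l ∈ integrableExpSet (U 0) P :=
      hmem.filter_mono nhdsWithin_le_nhds
    have h2 := hlit.filter_mono (nhdsWithin_le_nhds (s := Set.Ioi 0))
    obtain ⟨l, ⟨h1, h2⟩, h3⟩ := ((h1.and h2).and self_mem_nhdsWithin).exists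
    have h3 : 0 < l := h3
    refine ⟨l, ⟨?_, h1⟩, h3⟩
    simp only [mgf_zero, sub_zero, smul_eq_mul, mul_zero, Real.norm_eq_abs, abs_of_pos h3] at h2
    linarith [(abs_le.1 h2).2]
  refine ⟨l * ε / 2, by positivity, fun n s hs => ?_⟩
  have hint : ∀ k, Integrable (fun ω => Real.exp (l * U k ω)) P := fun k =>
    (((hid k).comp (u := fun x => Real.exp (l * x)) (by fun_prop)).integrable_iff).2 hl2
  have hmeas : ∀ k, AEMeasurable (U k) P := fun k => (hid k).aemeasurable_fst
  have hmgf : mgf (∑ k ∈ s, U k) P l ≤ Real.exp (ε / 4 * l) ^ (2 * n) := by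
    rw [hind.mgf_sum₀ hmeas]
    calc ∏ k ∈ s, mgf (U k) P l ≤ ∏ k ∈ s, Real.exp (ε / 4 * l) := by
          refine Finset.prod_le_prod (fun k _ => mgf_nonneg) fun k _ => ?_
          rw [mgf_congr_of_identDistrib _ _ (hid k)]
          linarith [Real.add_one_le_exp (ε / 4 * l)]
      _ = Real.exp (ε / 4 * l) ^ s.card := by simp
      _ ≤ Real.exp (ε / 4 * l) ^ (2 * n) := by
          refine pow_le_pow_right₀ ?_ hs
          rw [Real.one_le_exp_iff]; positivity
  have hintsum : Integrable (fun ω => Real.exp (l * (∑ k ∈ s, U k) ω)) P := by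
    refine Integrable.congr ?_ (ae_of_all _ fun ω => rfl)
    -- Without integrability the moment generating function would take its default value 0, but it
    -- is a product of positive factors.
    have hp : mgf (∑ k ∈ s, U k) P l ≠ 0 := by
      rw [hind.mgf_sum₀ hmeas]
      exact Finset.prod_ne_zero_iff.2 fun k _ => (mgf_pos (hint k)).ne'
    by_contra hc
    exact hp (mgf_undef hc)
  have hch := measure_ge_le_exp_mul_mgf (μ := P) (X := ∑ k ∈ s, U k) (ε * n) hl0.le hintsum
  simp only [Finset.sum_apply] at hch
  refine hch.trans ?_
  calc Real.exp (-l * (ε * n)) * mgf (∑ k ∈ s, U k) P l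
      ≤ Real.exp (-l * (ε * n)) * Real.exp (ε / 4 * l) ^ (2 * n) := by gcongr
    _ = Real.exp (-(l * ε / 2) * n) := by
      rw [← Real.exp_nat_mul, ← Real.exp_add]; congr 1; push_cast; ring

/-- The Taylor bound e^x ≥ x⁴/24 at x = c(m' + 1), together with (m' + 1)² ≥ m + 1, gives a majorant
of order 1/(m + 1)². -/
theorem summable_exp_neg_sqrt {c : ℝ} (hc : 0 < c) :
    Summable fun m : ℕ => Real.exp (-c * m.sqrt) := by
  have hs : Summable fun m : ℕ => Real.exp c * (24 / c ^ 4) * (1 / ((m + 1 : ℕ) : ℝ) ^ 2) :=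
    ((summable_nat_add_iff 1).2 (Real.summable_one_div_nat_pow.2 one_lt_two)).mul_left _
  refine Summable.of_nonneg_of_le (fun _ => (Real.exp_pos _).le) (fun m => ?_) hs
  have h1 : ((m + 1 : ℕ) : ℝ) ≤ ((m.sqrt : ℝ) + 1) ^ 2 := by
    have := Nat.succ_le_succ_sqrt m
    have h : ((m + 1 : ℕ) : ℝ) ≤ ((m.sqrt + 1) * (m.sqrt + 1) : ℕ) := by exact_mod_cast this
    push_cast at h ⊢
    nlinarith
  have h2 := Real.pow_div_factorial_le_exp (x := c * (m.sqrt + 1)) (by positivity) 4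
  have h3 : (4 : ℕ).factorial = 24 := rfl
  rw [h3] at h2
  have h4 : Real.exp (-c * m.sqrt) = Real.exp c / Real.exp (c * (m.sqrt + 1)) := by
    rw [← Real.exp_sub]; congr 1; ring
  rw [h4, div_eq_mul_one_div, mul_assoc]
  gcongr
  have h5 : ((m + 1 : ℕ) : ℝ) ^ 2 ≤ ((m.sqrt : ℝ) + 1) ^ 4 := by
    calc ((m + 1 : ℕ) : ℝ) ^ 2 ≤ (((m.sqrt : ℝ) + 1) ^ 2) ^ 2 := by gcongr
      _ = _ := by ring
  rw [div_mul_div_comm, mul_one, div_le_div_iff₀ (Real.exp_pos _) (by positivity), one_mul]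
  push_cast at h2
  rw [div_le_iff₀ (by norm_num), mul_pow] at h2
  calc c ^ 4 * ((m + 1 : ℕ) : ℝ) ^ 2 ≤ c ^ 4 * ((m.sqrt : ℝ) + 1) ^ 4 := by gcongr
    _ ≤ _ := by linarith

/-- Since m - m'² ≤ 2m', the exponential bound applies to this window; it is summable over m, so
Borel-Cantelli concludes. -/
theorem ae_eventually_sum_Ico_lt (hind : iIndepFun U P)
    (hid : ∀ k, IdentDistrib (U k) (U 0) P P) (h0 : 0 ∈ interior (integrableExpSet (U 0) P))
    (hmean : P[U 0] = 0) {ε : ℝ} (hε : 0 < ε) :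
    ∀ᵐ ω ∂P, ∀ᶠ m : ℕ in atTop,
      ∑ k ∈ Finset.Ico (m.sqrt * m.sqrt) m, U k ω < ε * m.sqrt := by
  obtain ⟨c, hc, h⟩ := exists_measureReal_sum_ge_le hind hid h0 hmean hε
  have hb : ∀ m : ℕ, P {ω | ε * m.sqrt ≤ ∑ k ∈ Finset.Ico (m.sqrt * m.sqrt) m, U k ω} ≤
      ENNReal.ofReal (Real.exp (-c * m.sqrt)) := by
    intro m
    rw [← ofReal_measureReal]
    refine ENNReal.ofReal_le_ofReal (h _ _ ?_)
    have := Nat.sqrt_le_add m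
    rw [Nat.card_Ico]
    omega
  have hne : ∑' m : ℕ, P {ω | ε * m.sqrt ≤ ∑ k ∈ Finset.Ico (m.sqrt * m.sqrt) m, U k ω} ≠ ∞ :=
    ne_top_of_le_ne_top (summable_exp_neg_sqrt hc).tsum_ofReal_ne_top (ENNReal.tsum_le_tsum hb)
  filter_upwards [ae_eventually_notMem hne] with ω hω
  filter_upwards [hω] with m hm
  simpa using hm

theorem ae_tendsto_sum_Ico_div (hind : iIndepFun U P)
    (hid : ∀ k, IdentDistrib (U k) (U 0) P P) (h0 : 0 ∈ interior (integrableExpSet (U 0) P))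
    (hmean : P[U 0] = 0) :
    ∀ᵐ ω ∂P, Tendsto (fun m : ℕ =>
      (∑ k ∈ Finset.Ico (m.sqrt * m.sqrt) m, U k ω) / m.sqrt) atTop (𝓝 0) := by
  have hind' : iIndepFun (fun k ω => -U k ω) P := hind.comp (fun _ x => -x) fun _ => measurable_neg
  have hid' : ∀ k, IdentDistrib (fun ω => -U k ω) (fun ω => -U 0 ω) P P := fun k =>
    (hid k).comp measurable_neg
  have h0' : 0 ∈ interior (integrableExpSet (fun ω => -U 0 ω) P) := by
    have e : integrableExpSet (fun ω => -U 0 ω) P =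
        (Homeomorph.neg ℝ) ⁻¹' integrableExpSet (U 0) P := by
      ext l; simp [integrableExpSet]
    rw [e, ← Homeomorph.preimage_interior]
    simpa using h0
  have hmean' : P[fun ω => -U 0 ω] = 0 := by rw [integral_neg, hmean, neg_zero]
  have hp : ∀ j : ℕ, (0 : ℝ) < 1 / (j + 1) := fun j => by positivity
  have A := ae_all_iff.2 fun j : ℕ => ae_eventually_sum_Ico_lt hind hid h0 hmean (hp j)
  have B := ae_all_iff.2 fun j : ℕ => ae_eventually_sum_Ico_lt hind' hid' h0' hmean' (hp j)
  filter_upwards [A, B] with ω hA hB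
  rw [Metric.tendsto_nhds]
  intro ε hε
  obtain ⟨j, hj⟩ := exists_nat_one_div_lt hε
  filter_upwards [hA j, hB j, tendsto_natSqrt.eventually_ge_atTop 1] with m h1 h2 h3
  have h3 : (0 : ℝ) < m.sqrt := by exact_mod_cast h3
  rw [Finset.sum_neg_distrib] at h2
  rw [Real.dist_eq, sub_zero, abs_div, abs_of_pos h3, div_lt_iff₀ h3, abs_lt]
  have : 1 / ((j : ℝ) + 1) * m.sqrt < ε * m.sqrt := by gcongr
  constructor <;> linarith

end Deviations

/-! ### Averages over all tours and over the batched tours. -/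

section Averages

/-- Both averages have total weight one, so their difference is unchanged by centring at e. The
coefficients on the right are at most 1 and 2 for n = ⌊√m⌋, so the centred window sum over n and the
centred average are all that must vanish. -/
theorem average_sub_average_eq {m n : ℕ} (hm : 0 < m) (hn : 0 < n) (hnm : n * n ≤ m) (e : ℝ)
    (w : ℕ → ℝ) :
    n * ((∑ k ∈ Finset.range m, w k) / m - (∑ k ∈ Finset.range (n * n), w k) / (n * n : ℕ)) =
      (n * n / m : ℝ) * ((∑ k ∈ Finset.Ico (n * n) m, (w k - e)) / n) -
        (n * (m - n * n) / m : ℝ) * ((∑ k ∈ Finset.range (n * n), (w k - e)) / (n * n : ℕ)) := by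
  have h1 : ∑ k ∈ Finset.range m, w k =
      ∑ k ∈ Finset.range (n * n), w k + ∑ k ∈ Finset.Ico (n * n) m, w k :=
    (Finset.sum_range_add_sum_Ico _ hnm).symm
  have h2 : ((m - n * n : ℕ) : ℝ) = m - n * n := by push_cast [Nat.cast_sub hnm]; ring
  rw [h1, Finset.sum_sub_distrib, Finset.sum_sub_distrib]
  simp only [Finset.sum_const, Nat.card_Ico, Finset.card_range, nsmul_eq_mul, h2]
  push_cast
  field_simp
  ring

theorem tendsto_average_sub_average {w : ℕ → ℝ} {e : ℝ}
    (s2 : Tendsto (fun m : ℕ => (∑ k ∈ Finset.range (m.sqrt * m.sqrt), (w k - e)) /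
      (m.sqrt * m.sqrt : ℕ)) atTop (𝓝 0))
    (s3 : Tendsto (fun m : ℕ =>
      (∑ k ∈ Finset.Ico (m.sqrt * m.sqrt) m, (w k - e)) / m.sqrt) atTop (𝓝 0)) :
    Tendsto (fun m : ℕ => (m.sqrt : ℝ) * ((∑ k ∈ Finset.range m, w k) / m -
        (∑ k ∈ Finset.range (m.sqrt * m.sqrt), w k) / (m.sqrt * m.sqrt : ℕ))) atTop (𝓝 0) := by
  have hb1 : Tendsto (fun m : ℕ => (m.sqrt * m.sqrt / m : ℝ) *
      ((∑ k ∈ Finset.Ico (m.sqrt * m.sqrt) m, (w k - e)) / m.sqrt)) atTop (𝓝 0) := by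
    have s3' := s3.abs
    rw [abs_zero] at s3'
    refine squeeze_zero_norm (fun m => ?_) s3'
    rw [norm_mul, Real.norm_eq_abs, Real.norm_eq_abs]
    refine mul_le_of_le_one_left (abs_nonneg _) ?_
    rw [abs_of_nonneg (by positivity)]
    refine div_le_one_of_le₀ ?_ (by positivity)
    exact_mod_cast Nat.sqrt_le m
  have hb2 : Tendsto (fun m : ℕ => (m.sqrt * (m - m.sqrt * m.sqrt) / m : ℝ) *
      ((∑ k ∈ Finset.range (m.sqrt * m.sqrt), (w k - e)) / (m.sqrt * m.sqrt : ℕ)))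
      atTop (𝓝 0) := by
    have s2' := s2.abs.const_mul 2
    rw [abs_zero, mul_zero] at s2'
    refine squeeze_zero_norm (fun m => ?_) s2'
    rw [norm_mul, Real.norm_eq_abs, Real.norm_eq_abs]
    refine mul_le_mul_of_nonneg_right ?_ (abs_nonneg _)
    have h1 : ((m.sqrt * m.sqrt : ℕ) : ℝ) ≤ m := by exact_mod_cast Nat.sqrt_le m
    have h2 : (m : ℝ) ≤ (m.sqrt * m.sqrt + m.sqrt + m.sqrt : ℕ) := by
      exact_mod_cast Nat.sqrt_le_add m
    push_cast at h1 h2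
    have h3 : (0 : ℝ) ≤ m.sqrt := by positivity
    rw [abs_of_nonneg (div_nonneg (mul_nonneg h3 (by linarith)) (by positivity))]
    refine div_le_of_le_mul₀ (by positivity) (by norm_num) ?_
    nlinarith
  have hb := hb1.sub hb2
  rw [sub_zero] at hb
  refine hb.congr' ?_
  filter_upwards [eventually_ge_atTop 1, tendsto_natSqrt.eventually_ge_atTop 1] with m hm hn
  exact (average_sub_average_eq hm hn (Nat.sqrt_le m) e (w)).symm

variable {Ω : Type*} [MeasurableSpace Ω] {P : Measure Ω} [IsProbabilityMeasure P] {W : ℕ → Ω → ℝ}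

theorem ae_tendsto_averages (hind : iIndepFun W P)
    (hid : ∀ k, IdentDistrib (W k) (W 0) P P) (h0 : 0 ∈ interior (integrableExpSet (W 0) P)) :
    ∀ᵐ ω ∂P,
      Tendsto (fun m : ℕ => (∑ k ∈ Finset.range (m.sqrt * m.sqrt), W k ω) /
        (m.sqrt * m.sqrt : ℕ)) atTop (𝓝 P[W 0]) ∧
      Tendsto (fun m : ℕ => (m.sqrt : ℝ) * ((∑ k ∈ Finset.range m, W k ω) / m -
        (∑ k ∈ Finset.range (m.sqrt * m.sqrt), W k ω) / (m.sqrt * m.sqrt : ℕ))) atTop (𝓝 0) := by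
  have hint : Integrable (W 0) P := integrable_of_mem_interior_integrableExpSet h0
  set e := P[W 0] with he
  have hind' : iIndepFun (fun k ω => W k ω - e) P :=
    hind.comp (fun _ x => x - e) fun _ => by fun_prop
  have hid' : ∀ k, IdentDistrib (fun ω => W k ω - e) (fun ω => W 0 ω - e) P P := fun k =>
    (hid k).comp (u := fun x => x - e) (by fun_prop)
  have hset : integrableExpSet (fun ω => W 0 ω - e) P = integrableExpSet (W 0) P := by
    ext l
    have : ∀ ω, Real.exp (l * (W 0 ω - e)) = Real.exp (-l * e) * Real.exp (l * W 0 ω) := by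
      intro ω; rw [← Real.exp_add]; congr 1; ring
    simp only [integrableExpSet, Set.mem_ofPred_eq, this]
    exact integrable_const_mul_iff (Real.exp_pos _).ne'.isUnit _
  have h0' : 0 ∈ interior (integrableExpSet (fun ω => W 0 ω - e) P) := by rwa [hset]
  have hmean' : P[fun ω => W 0 ω - e] = 0 := by
    rw [integral_sub hint (integrable_const _)]; simp [he]
  have hsq : Tendsto (fun m : ℕ => m.sqrt * m.sqrt) atTop atTop :=
    tendsto_natSqrt.atTop_mul_atTop₀ tendsto_natSqrt
  have law := strong_law_ae_real W hint (fun i j hij => hind.indepFun hij) hid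
  have law' := strong_law_ae_real (fun k ω => W k ω - e)
    (integrable_of_mem_interior_integrableExpSet h0') (fun i j hij => hind'.indepFun hij) hid'
  have dev := ae_tendsto_sum_Ico_div hind' hid' h0' hmean'
  filter_upwards [law, law', dev] with ω s1 s2 s3
  refine ⟨s1.comp hsq, ?_⟩
  rw [hmean'] at s2
  have s2 := s2.comp hsq
  exact tendsto_average_sub_average s2 s3

end Averages

/-! ### Stability of the posterior parameters. -/

section PosteriorLimit

/-- The difference is expressed through n(a - b), the quantity that tends to 0. -/
theorem postSquares_sub_postSquares {n : ℕ} (hn : n ≠ 0) {m₀ : ℝ} (hm₀ : 0 < m₀) (μ₀ ν₀ σ₀ b : ℝ)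
    (y : Fin n → ℝ) :
    postSquares μ₀ m₀ ν₀ σ₀ ((∑ h, y h) / n) y - postSquares μ₀ m₀ ν₀ σ₀ b y =
      m₀ / (m₀ + n) * ((n * ((∑ h, y h) / n - b)) * ((∑ h, y h) / n + b - 2 * μ₀)) -
        (n * ((∑ h, y h) / n - b)) ^ 2 / n := by
  unfold postSquares
  rw [sum_sq_sub_eq y hn b]
  generalize (∑ h, y h) / (n : ℝ) = a
  generalize ∑ h, (y h - a) ^ 2 = c
  have : m₀ + n ≠ 0 := by positivity
  field_simp
  ring

variable {m₀ ν₀ σ₀ : ℝ}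

theorem postScale_pos (hm₀ : 0 < m₀) (hν₀ : 0 < ν₀) (hσ₀ : 0 < σ₀) (μ₀ : ℝ) {n : ℕ} (a : ℝ)
    (y : Fin n → ℝ) : 0 < postScale μ₀ m₀ ν₀ σ₀ a y := by
  have := postSquares_pos hm₀ hν₀ hσ₀ μ₀ a y
  rw [postScale_eq]
  positivity

/-- The prior term ν₀σ₀² alone bounds the scale below by a multiple of 1/(m₀ + n), and the locations
differ by n(a - b)/(m₀ + n). No lower bound on the empirical variance is needed, so σ_W = 0 is
covered. -/
theorem abs_postLocation_sub_div_postScale_le (hm₀ : 0 < m₀) (hν₀ : 0 < ν₀) (hσ₀ : 0 < σ₀)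
    (μ₀ : ℝ) {n : ℕ} (a b : ℝ) (y : Fin n → ℝ) :
    |(postLocation μ₀ m₀ n a - postLocation μ₀ m₀ n b) / postScale μ₀ m₀ ν₀ σ₀ a y| ≤
      Real.sqrt ((1 + ν₀ / m₀) / (ν₀ * σ₀ ^ 2)) * |n * (a - b)| := by
  have hs := postScale_pos hm₀ hν₀ hσ₀ μ₀ a y
  have h1 : postLocation μ₀ m₀ n a - postLocation μ₀ m₀ n b = n * (a - b) / (m₀ + n) := by
    unfold postLocation; ring
  rw [h1, abs_div, abs_div, abs_of_pos hs, abs_of_pos (by positivity : 0 < m₀ + (n : ℝ)), div_div,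
    div_eq_mul_inv, mul_comm]
  gcongr
  have h2 : ν₀ * σ₀ ^ 2 ≤ postSquares μ₀ m₀ ν₀ σ₀ a y := by
    unfold postSquares
    have : 0 ≤ ∑ h, (y h - a) ^ 2 := Finset.sum_nonneg fun _ _ => sq_nonneg _
    have : 0 ≤ m₀ * n * (a - μ₀) ^ 2 / (m₀ + n) := by positivity
    linarith
  refine Real.le_sqrt_of_sq_le ?_
  rw [inv_pow, mul_pow, postScale_eq, Real.sq_sqrt (by
    have := postSquares_pos hm₀ hν₀ hσ₀ μ₀ a y; positivity)]
  rw [inv_eq_one_div, div_le_div_iff₀ (by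
    have := postSquares_pos hm₀ hν₀ hσ₀ μ₀ a y; positivity) (by positivity), one_mul]
  have h3 : (1 + ν₀ / m₀) * ((m₀ + n) ^ 2 *
      (postSquares μ₀ m₀ ν₀ σ₀ a y / ((ν₀ + n) * (m₀ + n)))) =
      postSquares μ₀ m₀ ν₀ σ₀ a y * ((1 + ν₀ / m₀) * (m₀ + n) / (ν₀ + n)) := by
    have : ν₀ + n ≠ 0 := by positivity
    have : m₀ + n ≠ 0 := by positivity
    field_simp
  rw [h3]
  have h4 : 1 ≤ (1 + ν₀ / m₀) * (m₀ + n) / (ν₀ + n) := by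
    rw [le_div_iff₀ (by positivity), one_mul]
    have : (1 + ν₀ / m₀) * (m₀ + n) = m₀ + n + ν₀ + ν₀ / m₀ * n := by field_simp; ring
    rw [this]
    have : 0 ≤ ν₀ / m₀ * n := by positivity
    linarith
  nlinarith [postSquares_pos hm₀ hν₀ hσ₀ μ₀ a y]

/-- The marginal posterior is asymptotically the Student distribution whose parameters are computed
from `b` instead of the sample mean, if the difference of the two is small. -/
theorem tendstoTotalVariation_marginalPosterior (hm₀ : 0 < m₀) (hν₀ : 0 < ν₀) (hσ₀ : 0 < σ₀)
    (μ₀ : ℝ) {y : ∀ m : ℕ, Fin m.sqrt → ℝ} {b : ℕ → ℝ} {e : ℝ}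
    (ha : Tendsto (fun m => (∑ h, y m h) / m.sqrt) atTop (𝓝 e))
    (hab : Tendsto (fun m => (m.sqrt : ℝ) * ((∑ h, y m h) / m.sqrt - b m)) atTop (𝓝 0)) :
    TendstoTotalVariation (fun m => marginalPosterior μ₀ m₀ ν₀ σ₀ (y m))
      (fun m => studentMeasure (ν₀ + (m.sqrt : ℝ)) (postLocation μ₀ m₀ m.sqrt (b m))
        (postScale μ₀ m₀ ν₀ σ₀ (b m) (y m))) := by
  set a : ℕ → ℝ := fun m => (∑ h, y m h) / m.sqrt with hadef
  have hn1 : ∀ᶠ m : ℕ in atTop, 1 ≤ m.sqrt := tendsto_natSqrt.eventually_ge_atTop 1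
  have hnR : Tendsto (fun m : ℕ => (m.sqrt : ℝ)) atTop atTop :=
    tendsto_natCast_atTop_atTop.comp tendsto_natSqrt
  have hdiff : Tendsto (fun m => a m - b m) atTop (𝓝 0) := by
    refine squeeze_zero_norm' ?_ (by simpa using hab.abs)
    filter_upwards [hn1] with m hm
    have hm : (1 : ℝ) ≤ m.sqrt := by exact_mod_cast hm
    change |a m - b m| ≤ m.sqrt * |a m - b m|
    nlinarith [abs_nonneg (a m - b m)]
  have hb : Tendsto b atTop (𝓝 e) := by
    simpa using ha.sub hdiff
  have key : TendstoTotalVariation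
      (fun m => studentMeasure (ν₀ + (m.sqrt : ℝ)) (postLocation μ₀ m₀ m.sqrt (a m))
        (postScale μ₀ m₀ ν₀ σ₀ (a m) (y m)))
      (fun m => studentMeasure (ν₀ + (m.sqrt : ℝ)) (postLocation μ₀ m₀ m.sqrt (b m))
        (postScale μ₀ m₀ ν₀ σ₀ (b m) (y m))) := by
    refine tendstoTotalVariation_studentMeasure ?_
      (Eventually.of_forall fun m => postScale_pos hm₀ hν₀ hσ₀ μ₀ _ _)
      (Eventually.of_forall fun m => postScale_pos hm₀ hν₀ hσ₀ μ₀ _ _) ?_ ?_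
    · filter_upwards [hn1] with m hm
      have hm : (1 : ℝ) ≤ m.sqrt := by exact_mod_cast hm
      linarith
    · have := hab.abs.const_mul (Real.sqrt ((1 + ν₀ / m₀) / (ν₀ * σ₀ ^ 2)))
      rw [abs_zero, mul_zero] at this
      exact squeeze_zero_norm
        (fun m => abs_postLocation_sub_div_postScale_le hm₀ hν₀ hσ₀ μ₀ (a m) (b m) (y m)) this
    · set A : ℕ → ℝ := fun m => postSquares μ₀ m₀ ν₀ σ₀ (a m) (y m) with hA
      set B : ℕ → ℝ := fun m => postSquares μ₀ m₀ ν₀ σ₀ (b m) (y m) with hB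
      -- A lower bound uniform in m turns A - B → 0 into A/B → 1.
      have hBlow : ∀ m, ν₀ * σ₀ ^ 2 ≤ B m := by
        intro m
        simp only [hB, postSquares]
        have : 0 ≤ ∑ h, (y m h - b m) ^ 2 := Finset.sum_nonneg fun _ _ => sq_nonneg _
        have : 0 ≤ m₀ * m.sqrt * (b m - μ₀) ^ 2 / (m₀ + m.sqrt) := by positivity
        linarith
      have hc : 0 < ν₀ * σ₀ ^ 2 := by positivity
      have hAB : Tendsto (fun m => A m - B m) atTop (𝓝 0) := by
        have t1 : Tendsto (fun m : ℕ => m₀ / (m₀ + (m.sqrt : ℝ))) atTop (𝓝 0) :=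
          tendsto_const_nhds.div_atTop (tendsto_atTop_add_const_left _ _ hnR)
        have t2 := (t1.mul (hab.mul ((ha.add hb).sub_const (2 * μ₀)))).sub
          ((hab.pow 2).div_atTop hnR)
        simp only [zero_mul, sub_zero] at t2
        refine t2.congr' ?_
        filter_upwards [hn1] with m hm
        exact (postSquares_sub_postSquares (by omega) hm₀ μ₀ ν₀ σ₀ (b m) (y m)).symm
      have hratio : Tendsto (fun m => A m / B m) atTop (𝓝 1) := by
        have h1 : Tendsto (fun m => (A m - B m) / B m) atTop (𝓝 0) := by
          have h2 := hAB.abs.div_const (ν₀ * σ₀ ^ 2)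
          rw [abs_zero, zero_div] at h2
          refine squeeze_zero_norm (fun m => ?_) h2
          have := hBlow m
          rw [Real.norm_eq_abs, abs_div, abs_of_pos (hc.trans_le this)]
          gcongr
        have h3 := h1.add_const 1
        rw [zero_add] at h3
        refine h3.congr fun m => ?_
        have := hc.trans_le (hBlow m)
        field_simp
        ring
      have hs := (Real.continuous_sqrt.tendsto 1).comp hratio
      rw [Real.sqrt_one] at hs
      refine hs.congr fun m => ?_
      simp only [Function.comp_apply, postScale_eq]
      have hApos : 0 < A m := postSquares_pos hm₀ hν₀ hσ₀ μ₀ _ _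
      have hBpos := hc.trans_le (hBlow m)
      rw [← Real.sqrt_div (by positivity)]
      congr 1
      have : ν₀ + (m.sqrt : ℝ) ≠ 0 := by positivity
      have : m₀ + (m.sqrt : ℝ) ≠ 0 := by positivity
      simp only [hA, hB] at hApos hBpos ⊢
      field_simp
  intro ε hε
  filter_upwards [key ε hε, hn1] with m hm hn S hS
  rw [marginalPosterior_eq_studentMeasure hm₀ hν₀ hσ₀ μ₀ (by omega)]
  exact hm S hS

end PosteriorLimit

/-! ### The augmented multigraph and the walk killed at the super-node. -/

section SuperGraph

set_option linter.unusedSectionVars false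

variable {V : Type*} [Fintype V] [DecidableEq V] (G : SimpleGraph V) [DecidableRel G.Adj]
  (I : Finset V)

theorem edgeMult_comm (a b : SuperVertex I) : edgeMult G I a b = edgeMult G I b a := by
  rcases a with _ | a <;> rcases b with _ | b <;> simp [edgeMult, G.adj_comm]

theorem edgeMult_some_none_pos {u : V} (hu : u ∈ I) {v : {v : V // v ∉ I}} (h : G.Adj u v) :
    0 < edgeMult G I (some v) none :=
  Finset.card_pos.2 ⟨u, Finset.mem_filter.2 ⟨hu, h⟩⟩

theorem superDegree_pos_of_edgeMult {a b : SuperVertex I} (h : 0 < edgeMult G I a b) :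
    0 < superDegree G I a :=
  h.trans_le (Finset.single_le_sum (f := fun b => edgeMult G I a b) (fun _ _ => Nat.zero_le _)
    (Finset.mem_univ b))

variable {G I}

/-- Induction along a path from a seed. It serves for p = membership in I and for p = vanishing of
the limit mass. -/
theorem eq_of_adj_of_reachable {p : V → Prop} (hI : ∀ v ∈ I, p v)
    (hstep : ∀ a b, G.Adj a b → p a → p b) (hspan : ∀ v : V, ∃ u ∈ I, G.Reachable u v) (v : V) :
    p v := by
  obtain ⟨u, hu, huv⟩ := hspan v
  rw [SimpleGraph.reachable_iff_reflTransGen] at huv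
  induction huv with
  | refl => exact hI u hu
  | tail _ hab ih => exact hstep _ _ hab ih

theorem superDegree_pos (hspan : ∀ v : V, ∃ u ∈ I, G.Reachable u v) (hproper : ∃ v : V, v ∉ I)
    (a : SuperVertex I) : 0 < superDegree G I a := by
  rcases a with _ | ⟨v, hv⟩
  -- If the super-node had no edges, I would be closed under adjacency and hence all of V.
  · by_contra h0
    obtain ⟨v, hv⟩ := hproper
    refine hv (eq_of_adj_of_reachable (p := fun v => v ∈ I) (fun _ h => h) ?_ hspan v)
    intro a b hab ha
    by_contra hb
    refine h0 (superDegree_pos_of_edgeMult G I (b := some ⟨b, hb⟩) ?_)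
    rw [edgeMult_comm]
    exact edgeMult_some_none_pos G I ha hab
  · obtain ⟨u, hu, huv⟩ := hspan v
    rw [SimpleGraph.reachable_iff_reflTransGen] at huv
    rcases huv.cases_tail with h | ⟨w, -, hw⟩
    · exact absurd (h ▸ hu) hv
    · by_cases hwI : w ∈ I
      · exact superDegree_pos_of_edgeMult G I (edgeMult_some_none_pos G I (v := ⟨v, hv⟩) hwI hw)
      · refine superDegree_pos_of_edgeMult G I (b := some ⟨w, hwI⟩) ?_
        simp [edgeMult, hw.symm]

theorem stepProb_nonneg (a b : SuperVertex I) : 0 ≤ stepProb G I a b := by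
  unfold stepProb; positivity

theorem superDegree_mul_stepProb {a : SuperVertex I} (ha : 0 < superDegree G I a)
    (b : SuperVertex I) : (superDegree G I a : ℝ) * stepProb G I a b = edgeMult G I a b := by
  have : (superDegree G I a : ℝ) ≠ 0 := by positivity
  unfold stepProb
  field_simp

theorem sum_stepProb {a : SuperVertex I} (ha : 0 < superDegree G I a) :
    ∑ b, stepProb G I a b = 1 := by
  have : (superDegree G I a : ℝ) ≠ 0 := by positivity
  unfold stepProb
  rw [← Finset.sum_div, ← Nat.cast_sum]
  exact div_self this

variable (G I) in
/-- The stationary measure of the walk, normalised to one at the super-node, and pushed forward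
`t` times by the walk killed at the super-node. -/
def killedMass : ℕ → {v : V // v ∉ I} → ℝ
  | 0 => fun u => (superDegree G I (some u) : ℝ) / superDegree G I none
  | t + 1 => fun v => ∑ u, killedMass t u * stepProb G I (some u) (some v)

theorem killedMass_succ (t : ℕ) (v : {v : V // v ∉ I}) :
    killedMass G I (t + 1) v = ∑ u, killedMass G I t u * stepProb G I (some u) (some v) := rfl

theorem killedMass_nonneg (t : ℕ) (v : {v : V // v ∉ I}) : 0 ≤ killedMass G I t v := by
  induction t generalizing v with
  | zero => unfold killedMass; positivity
  | succ t ih => exact Finset.sum_nonneg fun u _ => mul_nonneg (ih u) (stepProb_nonneg _ _)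

/-- Detailed balance: the mass sent from u to v is the multiplicity of the edge divided by d_S.
Summing over u outside I gives d_v/d_S less the share of the edges from v to the super-node. -/
theorem killedMass_zero_sub_one (hd : ∀ a, 0 < superDegree G I a) (v : {v : V // v ∉ I}) :
    killedMass G I 0 v - killedMass G I 1 v = stepProb G I none (some v) := by
  have h1 : ∀ u : {v : V // v ∉ I}, killedMass G I 0 u * stepProb G I (some u) (some v) =
      (edgeMult G I (some v) (some u) : ℝ) / superDegree G I none := by
    intro u
    rw [killedMass, div_mul_eq_mul_div, superDegree_mul_stepProb (hd _), edgeMult_comm]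
  rw [killedMass_succ, Finset.sum_congr rfl fun u _ => h1 u, ← Finset.sum_div, killedMass,
    ← sub_div, stepProb, edgeMult_comm]
  congr 1
  rw [superDegree, Fintype.sum_option]
  push_cast
  ring

theorem killedMass_succ_le (hd : ∀ a, 0 < superDegree G I a) (t : ℕ) (v : {v : V // v ∉ I}) :
    killedMass G I (t + 1) v ≤ killedMass G I t v := by
  induction t generalizing v with
  | zero =>
    have := killedMass_zero_sub_one hd v
    linarith [stepProb_nonneg (G := G) (I := I) none (some v)]
  | succ t ih =>
    rw [killedMass_succ, killedMass_succ]
    gcongr with u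
    · exact stepProb_nonneg _ _
    · exact ih u

/-- The masses decrease, so they have a limit β with β = βQ. Invariance leaves no mass to leak into
the super-node, so β vanishes next to I; and β(a) = 0 = ∑ β(u)p(u, a) forces β = 0 at the neighbours
of a outside I. -/
theorem tendsto_killedMass (hspan : ∀ v : V, ∃ u ∈ I, G.Reachable u v)
    (hd : ∀ a, 0 < superDegree G I a) (v : {v : V // v ∉ I}) :
    Tendsto (fun t => killedMass G I t v) atTop (𝓝 0) := by
  have hlim : ∀ v, ∃ l, Tendsto (fun t => killedMass G I t v) atTop (𝓝 l) := fun v =>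
    ⟨_, tendsto_atTop_ciInf (antitone_nat_of_succ_le fun t => killedMass_succ_le hd t v)
      ⟨0, by rintro _ ⟨t, rfl⟩; exact killedMass_nonneg t v⟩⟩
  choose β hβ using hlim
  have hβ0 : ∀ v, 0 ≤ β v := fun v =>
    ge_of_tendsto' (hβ v) fun t => killedMass_nonneg t v
  have hfix : ∀ v, β v = ∑ u, β u * stepProb G I (some u) (some v) := fun v =>
    tendsto_nhds_unique ((hβ v).comp (tendsto_add_atTop_nat 1))
      (tendsto_finsetSum _ fun u _ => (hβ u).mul_const _)
  have hmass : ∑ u, β u * stepProb G I (some u) none = 0 := by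
    have h1 : ∑ v, β v = ∑ u, β u * ∑ v, stepProb G I (some u) (some v) := by
      simp_rw [Finset.mul_sum]
      rw [Finset.sum_comm]
      exact Finset.sum_congr rfl fun v _ => hfix v
    have h2 : ∀ u : {v : V // v ∉ I}, ∑ v, stepProb G I (some u) (some v) =
        1 - stepProb G I (some u) none := by
      intro u
      rw [← sum_stepProb (hd (some u)), Fintype.sum_option]
      ring
    simp_rw [h2, mul_sub, mul_one, Finset.sum_sub_distrib] at h1
    linarith
  have hseed : ∀ u, β u * stepProb G I (some u) none = 0 := fun u =>
    (Finset.sum_eq_zero_iff_of_nonneg fun u _ => mul_nonneg (hβ0 u) (stepProb_nonneg _ _)).1 hmass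
      u (Finset.mem_univ u)
  have hpos : ∀ a b : SuperVertex I, 0 < edgeMult G I a b → 0 < stepProb G I a b := by
    intro a b hab
    have := hd a
    unfold stepProb
    positivity
  have hall : ∀ v : V, ∀ hv : v ∉ I, β ⟨v, hv⟩ = 0 := by
    refine eq_of_adj_of_reachable (p := fun v => ∀ hv : v ∉ I, β ⟨v, hv⟩ = 0)
      (fun v hv hv' => absurd hv hv') ?_ hspan
    intro a b hab ha hb
    by_cases haI : a ∈ I
    · have h1 := hpos _ _ (edgeMult_some_none_pos G I (v := ⟨b, hb⟩) haI hab)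
      exact (mul_eq_zero.1 (hseed ⟨b, hb⟩)).resolve_right h1.ne'
    · have h0 := hfix ⟨a, haI⟩
      rw [ha haI] at h0
      have h1 := (Finset.sum_eq_zero_iff_of_nonneg fun u _ =>
        mul_nonneg (hβ0 u) (stepProb_nonneg _ _)).1 h0.symm ⟨b, hb⟩ (Finset.mem_univ _)
      have h2 := hpos (some ⟨b, hb⟩) (some ⟨a, haI⟩) (by simp [edgeMult, hab.symm])
      exact (mul_eq_zero.1 h1).resolve_right h2.ne'
  have := hβ v
  rwa [hall v v.2] at this

/-- The initial mass is positive at each of finitely many nodes, so one K halves all of them. The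
nonnegative kernel preserves the inequality at later times. -/
theorem exists_killedMass_add_le_half (hspan : ∀ v : V, ∃ u ∈ I, G.Reachable u v)
    (hd : ∀ a, 0 < superDegree G I a) :
    ∃ K : ℕ, ∀ t v, killedMass G I (t + K) v ≤ killedMass G I t v / 2 := by
  have h : ∀ v : {v : V // v ∉ I},
      ∀ᶠ t in atTop, killedMass G I t v ≤ killedMass G I 0 v / 2 := by
    intro v
    refine (tendsto_killedMass hspan hd v).eventually (Iic_mem_nhds ?_)
    have := hd (some v)
    have := hd none
    unfold killedMass
    positivity
  obtain ⟨K, hK⟩ := (eventually_all.2 h).exists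
  refine ⟨K, fun t => ?_⟩
  induction t with
  | zero => simpa using hK
  | succ t ih =>
    intro v
    rw [show t + 1 + K = t + K + 1 by ring, killedMass_succ, killedMass_succ, Finset.sum_div]
    refine Finset.sum_le_sum fun u _ => ?_
    rw [mul_div_right_comm]
    exact mul_le_mul_of_nonneg_right (ih u) (stepProb_nonneg _ _)

theorem exists_summable_exp_mul {c : ℕ → ℝ} (hc : ∀ t, 0 ≤ c t) {K : ℕ}
    (hK : ∀ t, c (t + K) ≤ c t / 2) :
    ∃ l : ℝ, 0 < l ∧ Summable fun t : ℕ => Real.exp (l * t) * c t := by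
  -- With e^{lK} ≤ 3/2, a shift by K multiplies the terms by at most 3/4, so a partial sum S
  -- satisfies S ≤ S_K + (3/4)S, that is S ≤ 4S_K.
  obtain ⟨l, hl1, hl0⟩ : ∃ l : ℝ, Real.exp (l * K) ≤ 3 / 2 ∧ 0 < l := by
    have h1 : ContinuousAt (fun l : ℝ => Real.exp (l * K)) 0 := by fun_prop
    have h2 := (h1.tendsto.mono_left (nhdsWithin_le_nhds (s := Set.Ioi 0))).eventually
      (p := fun x => x ≤ 3 / 2) (Iic_mem_nhds (by simp; norm_num))
    obtain ⟨l, h3, h4⟩ := (h2.and self_mem_nhdsWithin).exists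
    exact ⟨l, h3, h4⟩
  refine ⟨l, hl0, ?_⟩
  have hterm : ∀ t : ℕ, 0 ≤ Real.exp (l * t) * c t := fun t => mul_nonneg (Real.exp_pos _).le (hc t)
  refine summable_of_sum_range_le (c := 4 * ∑ t ∈ Finset.range K, Real.exp (l * t) * c t) hterm
    fun N => ?_
  have h1 : ∑ t ∈ Finset.range N, Real.exp (l * t) * c t ≤
      ∑ t ∈ Finset.range (K + N), Real.exp (l * t) * c t :=
    Finset.sum_le_sum_of_subset_of_nonneg (Finset.range_mono (by omega)) fun t _ _ => hterm t
  rw [Finset.sum_range_add] at h1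
  have h2 : ∑ t ∈ Finset.range N, Real.exp (l * (K + t : ℕ)) * c (K + t) ≤
      ∑ t ∈ Finset.range N, 3 / 4 * (Real.exp (l * t) * c t) := by
    refine Finset.sum_le_sum fun t _ => ?_
    have h3 := hK t
    rw [add_comm t K] at h3
    have h4 : Real.exp (l * (K + t : ℕ)) = Real.exp (l * K) * Real.exp (l * t) := by
      rw [← Real.exp_add]; congr 1; push_cast; ring
    rw [h4]
    calc Real.exp (l * K) * Real.exp (l * t) * c (K + t)
        ≤ 3 / 2 * Real.exp (l * t) * (c t / 2) := by
          gcongr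
          have := hc (K + t)
          linarith
      _ = _ := by ring
  rw [← Finset.mul_sum] at h2
  linarith

theorem exists_summable_exp_mul_killedMass (hspan : ∀ v : V, ∃ u ∈ I, G.Reachable u v)
    (hd : ∀ a, 0 < superDegree G I a) :
    ∃ l : ℝ, 0 < l ∧ Summable fun t : ℕ => Real.exp (l * t) * ∑ v, killedMass G I t v := by
  obtain ⟨K, hK⟩ := exists_killedMass_add_le_half hspan hd
  refine exists_summable_exp_mul (fun t => Finset.sum_nonneg fun v _ => killedMass_nonneg t v)
    (K := K) fun t => ?_
  rw [Finset.sum_div]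
  exact Finset.sum_le_sum fun v _ => hK t v

/-- Double counting of the edges that avoid the seed set. -/
theorem sum_edgeMult_mul_superFun (f : Sym2 V → ℝ) :
    ∑ u : {v : V // v ∉ I}, ∑ v : {v : V // v ∉ I},
      (edgeMult G I (some u) (some v) : ℝ) * superFun I f (some u) (some v) =
      2 * (edgeTotal G f - seedTotal G I f) := by
  classical
  -- Setting f to 0 on edges that touch I lets the sum run over all darts of G, two for each edge.
  set F : Sym2 V → ℝ := fun e => if ∃ u ∈ I, u ∈ e then 0 else f e with hF
  have h1 : edgeTotal G f - seedTotal G I f = ∑ e ∈ G.edgeFinset, F e := by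
    rw [edgeTotal, seedTotal, Finset.sum_filter, ← Finset.sum_sub_distrib]
    refine Finset.sum_congr rfl fun e _ => ?_
    simp only [hF]
    split_ifs <;> simp
  have h2 : ∑ d : G.Dart, F d.edge = 2 * ∑ e ∈ G.edgeFinset, F e := by
    rw [← Finset.sum_fiberwise_of_maps_to (s := Finset.univ) (t := G.edgeFinset)
      (g := fun d : G.Dart => d.edge) (fun d _ => by simp [d.edge_mem]), Finset.mul_sum]
    refine Finset.sum_congr rfl fun e he => ?_
    rw [Finset.sum_congr rfl (g := fun _ => F e)
      fun d hd => by rw [(Finset.mem_filter.1 hd).2], Finset.sum_const,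
      G.dart_edge_fiber_card e (SimpleGraph.mem_edgeFinset.1 he)]
    simp
  have h3 : ∑ d : G.Dart, F d.edge = ∑ u : V, ∑ v : V, if G.Adj u v then F s(u, v) else 0 := by
    rw [← Fintype.sum_prod_type' (f := fun u v => if G.Adj u v then F s(u, v) else 0),
      ← Finset.sum_filter]
    refine Finset.sum_bij (fun d _ => d.toProd) (fun d _ => by simp [d.adj])
      (fun d _ d' _ h => SimpleGraph.Dart.ext _ _ h) (fun p hp => ?_) (fun d _ => rfl)
    exact ⟨⟨p, (Finset.mem_filter.1 hp).2⟩, Finset.mem_univ _, rfl⟩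
  have h4 : ∀ g : V → ℝ, (∀ v ∈ I, g v = 0) → ∑ v : V, g v = ∑ v : {v : V // v ∉ I}, g v := by
    intro g hg
    rw [← Fintype.sum_subtype_add_sum_subtype (fun v => v ∈ I) g]
    exact add_eq_right.2 (Finset.sum_eq_zero fun v _ => hg v v.2)
  rw [h1, ← h2, h3, h4]
  · refine Finset.sum_congr rfl fun u _ => ?_
    rw [h4]
    · refine Finset.sum_congr rfl fun v _ => ?_
      have : ¬ ∃ w ∈ I, w ∈ s((u : V), (v : V)) := by
        rintro ⟨w, hw, h⟩
        rcases Sym2.mem_iff.1 h with rfl | rfl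
        · exact u.2 hw
        · exact v.2 hw
      simp only [edgeMult, superFun, hF, if_neg this]
      split_ifs <;> simp
    · intro v hv
      have : ∃ w ∈ I, w ∈ s((u : V), v) := ⟨v, hv, by simp⟩
      simp only [hF, if_pos this, ite_self]
  · intro u hu
    refine Finset.sum_eq_zero fun v _ => ?_
    have : ∃ w ∈ I, w ∈ s(u, v) := ⟨u, hu, by simp⟩
    simp only [hF, if_pos this, ite_self]

end SuperGraph

/-! ### Tours as words: decomposing a trajectory at its visits to `none`. -/

section Words

set_option linter.unusedSectionVars false

variable {α : Type*}

/-- The first `l.length` terms of the sequence `x` are the list `l`. -/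
def Follows (x : ℕ → α) (l : List α) : Prop := (List.range l.length).map x = l

theorem follows_append {x : ℕ → α} {l l' : List α} :
    Follows x (l ++ l') ↔ Follows x l ∧ Follows (fun i => x (l.length + i)) l' := by
  unfold Follows
  rw [List.length_append, List.range_add, List.map_append, List.map_map]
  constructor
  · intro h
    exact List.append_inj h (by simp)
  · rintro ⟨h, h'⟩
    congr 1

theorem follows_singleton {x : ℕ → α} {a : α} : Follows x [a] ↔ x 0 = a := by
  simp [Follows]

theorem follows_iff_forall_le {x : ℕ → α} {a : α} {l : List α} :
    Follows x (a :: l) ↔ ∀ t ≤ l.length, x t = (a :: l).getD t a := by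
  unfold Follows
  constructor
  · intro h t ht
    rw [← h]
    simp [List.getD_eq_getElem?_getD, Nat.lt_succ_of_le ht]
  · intro h
    refine List.ext_getElem (by simp) fun i h1 h2 => ?_
    have := h i (by simpa [Nat.lt_succ_iff] using h2)
    rw [List.getD_eq_getElem _ _ h2] at this
    simpa using this

variable [DecidableEq α]

theorem count_eq_of_follows {x : ℕ → Option α} {l : List (Option α)} (h : Follows x l) :
    Nat.count (fun t => x t = none) l.length = l.count none := by
  conv_rhs => rw [← h]
  rw [List.count, List.countP_map]
  simp only [Nat.count]
  congr 1
  ext t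
  rw [Bool.eq_iff_iff]
  simp

/-- A tour: the list starts with `none`, which does not occur again. -/
def IsTour (l : List (Option α)) : Prop := ∃ w, l = none :: w ∧ none ∉ w

theorem IsTour.count_eq {l : List (Option α)} (h : IsTour l) : l.count none = 1 := by
  obtain ⟨w, rfl, hw⟩ := h
  simp [List.count_eq_zero_of_not_mem hw]

theorem count_flatten_of_isTour {ls : List (List (Option α))} (h : ∀ l ∈ ls, IsTour l) :
    ls.flatten.count none = ls.length := by
  induction ls with
  | nil => simp
  | cons l ls ih =>
    rw [List.flatten_cons, List.count_append, (h l (by simp)).count_eq,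
      ih fun l' hl' => h l' (by simp [hl'])]
    simp [add_comm]

/-- Each tour contains exactly one `none`, so the number of visits before the end of the
concatenation is the number of tours. -/
theorem nth_eq_of_follows {x : ℕ → Option α} {ls : List (List (Option α))}
    (h : ∀ l ∈ ls, IsTour l) (hx : Follows x (ls.flatten ++ [none])) :
    Nat.nth (fun t => x t = none) ls.length = ls.flatten.length := by
  rw [follows_append, follows_singleton] at hx
  have h1 := count_eq_of_follows hx.1
  rw [count_flatten_of_isTour h] at h1
  rw [← h1]
  exact Nat.nth_count (p := fun t => x t = none) hx.2

/-- The values of the sequence `x` from its `k`-th visit to `none` until just before the next. -/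
def tourWord (x : ℕ → Option α) (k : ℕ) : List (Option α) :=
  (List.range' (Nat.nth (fun t => x t = none) k)
    (Nat.nth (fun t => x t = none) (k + 1) - Nat.nth (fun t => x t = none) k)).map x

theorem exists_flatten_append_eq_cons {ls : List (List (Option α))} (h : ∀ l ∈ ls, IsTour l) :
    ∃ r, ls.flatten ++ [none] = none :: r := by
  cases ls with
  | nil => exact ⟨[], rfl⟩
  | cons l ls =>
    obtain ⟨w, rfl, -⟩ := h l (by simp)
    exact ⟨w ++ (ls.flatten ++ [none]), by simp⟩

/-- What comes after `l` begins with `none`, whether it is another tour or the final letter. This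
fixes both end points of the tour as lengths of concatenations. -/
theorem tourWord_of_follows {x : ℕ → Option α} {as bs : List (List (Option α))}
    {l : List (Option α)} (h : ∀ l' ∈ as ++ l :: bs, IsTour l')
    (hx : Follows x ((as ++ l :: bs).flatten ++ [none])) : tourWord x as.length = l := by
  have has : ∀ l' ∈ as, IsTour l' := fun l' hl' => h l' (by simp [hl'])
  have hl : IsTour l := h l (by simp)
  have hasl : ∀ l' ∈ as ++ [l], IsTour l' := fun l' hl' => h l' (by
    rcases List.mem_append.1 hl' with h1 | h1
    · simp [h1]
    · simp [List.mem_singleton.1 h1])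
  obtain ⟨r, hr⟩ := exists_flatten_append_eq_cons (ls := bs) fun l' hl' => h l' (by simp [hl'])
  have e1 : (as ++ l :: bs).flatten ++ [none] = ((as ++ [l]).flatten ++ [none]) ++ r := by
    have : (as ++ l :: bs).flatten ++ [none] = as.flatten ++ l ++ (bs.flatten ++ [none]) := by
      simp
    rw [this, hr]
    simp
  rw [e1, follows_append] at hx
  obtain ⟨w, hw, -⟩ := hl
  have e2 : (as ++ [l]).flatten ++ [none] = (as.flatten ++ [none]) ++ (w ++ [none]) := by
    simp [hw]
  have e3 : (as ++ [l]).flatten ++ [none] = as.flatten ++ (l ++ [none]) := by simp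
  have n1 := nth_eq_of_follows hasl hx.1
  have n0 := nth_eq_of_follows has (follows_append.1 (e2 ▸ hx.1)).1
  have hf := (follows_append.1 (follows_append.1 (e3 ▸ hx.1)).2).1
  simp only [List.length_append, List.length_singleton, List.flatten_append, List.flatten_cons,
    List.flatten_nil, List.append_nil] at n1
  rw [tourWord, n1, n0, Nat.add_sub_cancel_left, List.range'_eq_map_range, List.map_map]
  exact hf

theorem follows_tourWord_zero {x : ℕ → Option α} (h0 : x 0 = none) (h1 : ∃ t, 1 ≤ t ∧ x t = none) :
    IsTour (tourWord x 0) ∧ Follows x (tourWord x 0 ++ [none]) := by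
  classical
  set N := Nat.find h1 with hN
  obtain ⟨hN1, hN2⟩ := Nat.find_spec h1
  have hlt : ∀ t, 1 ≤ t → t < N → x t ≠ none := fun t ht htN hx => Nat.find_min h1 htN ⟨ht, hx⟩
  set l := (List.range N).map x with hl
  have htour : IsTour l := by
    obtain ⟨M, hM⟩ : ∃ M, N = M + 1 := ⟨N - 1, by omega⟩
    refine ⟨(List.range M).map fun t => x (t + 1), ?_, ?_⟩
    · rw [hl, hM, List.range_succ_eq_map]
      simp [h0, Function.comp_def]
    · simp only [List.mem_map, List.mem_range, not_exists, not_and]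
      intro t ht
      exact hlt (t + 1) (by omega) (by omega)
  have hf : Follows x (l ++ [none]) := by
    rw [follows_append, follows_singleton]
    refine ⟨by simp [Follows, hl], ?_⟩
    simpa [hl] using hN2
  have := tourWord_of_follows (x := x) (as := []) (bs := []) (l := l)
    (by simpa using htour) (by simpa using hf)
  simp only [List.length_nil] at this
  rw [this]
  exact ⟨htour, hf⟩

theorem nth_zero_of_follows {x : ℕ → Option α} (h0 : x 0 = none) :
    Nat.nth (fun t => x t = none) 0 = 0 := by
  have := Nat.nth_count (p := fun t => x t = none) h0
  simpa using this

/-- Product of a transition kernel along the consecutive pairs of a list. -/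
def chainProb (q : α → α → ℝ) : List α → ℝ
  | [] => 1
  | [_] => 1
  | a :: b :: l => q a b * chainProb q (b :: l)

theorem chainProb_append (q : α → α → ℝ) (l l' : List α) (a : α) :
    chainProb q (l ++ a :: l') = chainProb q (l ++ [a]) * chainProb q (a :: l') := by
  induction l with
  | nil => simp [chainProb]
  | cons b l ih =>
    cases l with
    | nil => simp [chainProb]
    | cons c l =>
      simp only [List.cons_append, chainProb] at ih ⊢
      rw [ih, mul_assoc]

theorem prod_range_eq_chainProb (q : α → α → ℝ) (d a : α) (l : List α) :
    ∏ t ∈ Finset.range l.length, q ((a :: l).getD t d) ((a :: l).getD (t + 1) d) =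
      chainProb q (a :: l) := by
  induction l generalizing a with
  | nil => simp [chainProb]
  | cons b l ih =>
    rw [List.length_cons, Finset.prod_range_succ', chainProb, ← ih b, mul_comm]
    simp

/-- Consecutive tours share only the letter `none`, at which the product of transitions splits. This
is the regeneration property at the level of words. -/
theorem chainProb_flatten (q : Option α → Option α → ℝ) {ls : List (List (Option α))}
    (h : ∀ l ∈ ls, IsTour l) :
    chainProb q (ls.flatten ++ [none]) = (ls.map fun l => chainProb q (l ++ [none])).prod := by
  induction ls with
  | nil => simp [chainProb]
  | cons l ls ih =>
    have h' : ∀ l' ∈ ls, IsTour l' := fun l' hl' => h l' (by simp [hl'])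
    obtain ⟨r, hr⟩ := exists_flatten_append_eq_cons h'
    rw [List.flatten_cons, List.append_assoc, hr, chainProb_append, ← hr, ih h', List.map_cons,
      List.prod_cons]

end Words

/-! ### A criterion for i.i.d. sequences in a countable space. -/

section Regeneration

variable {Ω α : Type*} [MeasurableSpace Ω] [MeasurableSpace α] [MeasurableSingletonClass α]
  [Countable α] {P : Measure Ω} [IsProbabilityMeasure P]

/-- Random variables with values in a countable space are i.i.d. if the joint point probabilities
are at least the products of those of the first variable. -/
theorem iIndepFun_of_prod_le {T : ℕ → Ω → α} (hT : ∀ k, Measurable (T k))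
    (h : ∀ (K : ℕ) (a : Fin K → α), ∏ i, P {ω | T 0 ω = a i} ≤ P {ω | ∀ i : Fin K, T i ω = a i}) :
    iIndepFun T P ∧ ∀ k, IdentDistrib (T k) (T 0) P P := by
  have hprob : IsProbabilityMeasure (P.map (T 0)) :=
    Measure.isProbabilityMeasure_map (hT 0).aemeasurable
  have hmeas : ∀ K, Measurable fun ω (i : Fin K) => T i ω := fun K =>
    measurable_pi_iff.2 fun i => hT i
  have hpi : ∀ K : ℕ, (Measure.pi fun _ : Fin K => P.map (T 0)) =
      P.map fun ω (i : Fin K) => T i ω := by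
    intro K
    have : IsProbabilityMeasure (P.map fun ω (i : Fin K) => T i ω) :=
      Measure.isProbabilityMeasure_map (hmeas K).aemeasurable
    -- An inequality between two measures of total mass one is an equality; in a countable space it
    -- suffices to compare points.
    refine Measure.eq_of_le_of_measure_univ_eq ?_ (by simp)
    refine Measure.le_iff.2 fun s hs => ?_
    rw [← Measure.tsum_indicator_apply_singleton _ s hs,
      ← Measure.tsum_indicator_apply_singleton _ s hs]
    refine ENNReal.tsum_le_tsum fun a => Set.indicator_le_indicator ?_
    rw [Measure.pi_singleton, Measure.map_apply (hmeas K) (measurableSet_singleton a)]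
    calc ∏ i, P.map (T 0) {a i} = ∏ i, P {ω | T 0 ω = a i} := by
          refine Finset.prod_congr rfl fun i _ => ?_
          rw [Measure.map_apply (hT 0) (measurableSet_singleton _)]
          rfl
      _ ≤ _ := h K a
      _ = _ := by
          congr 1
          ext ω
          simp [funext_iff]
  have hident : ∀ k, IdentDistrib (T k) (T 0) P P := by
    intro k
    refine ⟨(hT k).aemeasurable, (hT 0).aemeasurable, ?_⟩
    have h1 := congrArg (Measure.map (Function.eval (Fin.last k))) (hpi (k + 1))
    rw [(measurePreserving_eval _ _).map_eq, Measure.map_map (by fun_prop) (hmeas _)] at h1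
    exact h1.symm
  refine ⟨?_, hident⟩
  have hfin : ∀ K : ℕ, iIndepFun (fun (i : Fin K) => T i) P := by
    intro K
    rw [iIndepFun_iff_map_fun_eq_pi_map fun i : Fin K => (hT i).aemeasurable, ← hpi K]
    congr 1
    ext1 i
    exact (hident i).map_eq.symm
  rw [iIndepFun_iff_finset]
  intro s
  have hs : ∀ i ∈ s, i < s.sup id + 1 := fun i hi => Nat.lt_succ_of_le (Finset.le_sup (f := id) hi)
  exact (hfin (s.sup id + 1)).precomp (g := fun i : s => ⟨i, hs i i.2⟩)
    fun i j hij => Subtype.ext (by simpa using hij)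

end Regeneration

/-! ### The law of the walk: independence of tours and survival probabilities. -/

section WalkLaw

set_option linter.unusedSectionVars false

variable {V : Type*} [Fintype V] [DecidableEq V] {G : SimpleGraph V} [DecidableRel G.Adj]
  {I : Finset V} {Ω : Type*} [MeasurableSpace Ω] {P : Measure Ω} [IsProbabilityMeasure P]
  {X : ℕ → Ω → SuperVertex I}

theorem measureReal_follows (hX : IsSuperWalk G I P X) (l : List (SuperVertex I)) :
    P.real {ω | Follows (fun t => X t ω) (none :: l)} = chainProb (stepProb G I) (none :: l) := by
  have h := hX.law l.length fun t => (none :: l).getD t none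
  rw [prod_range_eq_chainProb] at h
  simp only [follows_iff_forall_le]
  simpa using h

theorem measurableSet_map_eq (hX : IsSuperWalk G I P X) (ts : List ℕ) (l : List (SuperVertex I)) :
    MeasurableSet {ω | ts.map (fun t => X t ω) = l} := by
  induction ts generalizing l with
  | nil =>
    simp only [List.map_nil]
    exact MeasurableSet.const _
  | cons t ts ih =>
    cases l with
    | nil => simp
    | cons a l =>
      simp only [List.map_cons, List.cons.injEq]
      exact (hX.measurable t a).inter (ih l)

theorem measurable_count (hX : IsSuperWalk G I P X) (n : ℕ) :
    Measurable fun ω => Nat.count (fun t => X t ω = none) n := by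
  induction n with
  | zero => simp
  | succ n ih =>
    simp only [Nat.count_succ]
    exact ih.add (Measurable.ite (hX.measurable n none) measurable_const measurable_const)

theorem measurable_visitTime (hX : IsSuperWalk G I P X) (k : ℕ) : Measurable (visitTime X k) := by
  refine measurable_to_countable' fun t => ?_
  have hvisit : ∀ s, MeasurableSet
      {ω | X s ω = none ∧ Nat.count (fun t => X t ω = none) s = k} := fun s =>
    (hX.measurable s none).inter (measurable_count hX s (measurableSet_singleton k))
  -- `Nat.nth` returns 0 when there are too few visits; the second set accounts for this default.
  have heq : visitTime X k ⁻¹' {t} =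
      {ω | X t ω = none ∧ Nat.count (fun t => X t ω = none) t = k} ∪
        ({ω | t = 0} ∩ ⋂ s, {ω | X s ω = none ∧ Nat.count (fun t => X t ω = none) s = k}ᶜ) := by
    ext ω
    simp only [Set.mem_preimage, Set.mem_singleton_iff, Set.mem_union, Set.mem_inter_iff,
      Set.mem_iInter, Set.mem_compl_iff, Set.mem_ofPred_eq, visitTime]
    by_cases hex : ∃ s, X s ω = none ∧ Nat.count (fun t => X t ω = none) s = k
    · obtain ⟨s, hs, hc⟩ := hex
      have hn : Nat.nth (fun t => X t ω = none) k = s := by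
        rw [← hc]
        exact Nat.nth_count (p := fun t => X t ω = none) hs
      rw [hn]
      constructor
      · rintro rfl
        exact Or.inl ⟨hs, hc⟩
      · rintro (⟨ht, hct⟩ | ⟨-, hall⟩)
        · rw [← hn, ← hct]
          exact Nat.nth_count (p := fun t => X t ω = none) ht
        · exact absurd ⟨hs, hc⟩ (hall s)
    · have h0 : Nat.nth (fun t => X t ω = none) k = 0 := by
        by_contra h0
        have hcard : ∀ hf : (Set.ofPred fun t => X t ω = none).Finite, k < hf.toFinset.card := by
          intro hf
          by_contra hk
          exact h0 (Nat.nth_of_card_le hf (not_lt.1 hk))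
        exact hex ⟨_, Nat.nth_mem _ hcard, Nat.count_nth hcard⟩
      rw [h0]
      constructor
      · intro h
        exact Or.inr ⟨h.symm, fun s hs => hex ⟨s, hs⟩⟩
      · rintro (h | ⟨h, -⟩)
        · exact absurd ⟨t, h⟩ hex
        · exact h.symm
  rw [heq]
  exact (hvisit t).union ((MeasurableSet.const _).inter
    (MeasurableSet.iInter fun s => (hvisit s).compl))

theorem measurableSet_tourWord_eq (hX : IsSuperWalk G I P X) (k : ℕ)
    (l : List (SuperVertex I)) : MeasurableSet {ω | tourWord (fun t => X t ω) k = l} := by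
  have heq : {ω | tourWord (fun t => X t ω) k = l} = ⋃ a : ℕ, ⋃ b : ℕ,
      (visitTime X k ⁻¹' {a} ∩ visitTime X (k + 1) ⁻¹' {b}) ∩
        {ω | (List.range' a (b - a)).map (fun t => X t ω) = l} := by
    ext ω
    simp [tourWord, visitTime]
  rw [heq]
  exact MeasurableSet.iUnion fun a => MeasurableSet.iUnion fun b =>
    ((measurable_visitTime hX k (measurableSet_singleton a)).inter
      (measurable_visitTime hX (k + 1) (measurableSet_singleton b))).inter
        (measurableSet_map_eq hX _ l)

/-- The sum of the edge function along the consecutive pairs of a tour. -/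
def wordSum (f : Sym2 V → ℝ) (l : List (SuperVertex I)) : ℝ :=
  ∑ t ∈ Finset.Ico 1 l.length, superFun I f (l.getD (t - 1) none) (l.getD t none)

theorem tourSum_eq_wordSum (f : Sym2 V → ℝ) (X : ℕ → Ω → SuperVertex I) (k : ℕ) (ω : Ω) :
    tourSum f X k ω = wordSum f (tourWord (fun t => X t ω) k) := by
  set a := visitTime X k ω with ha
  set b := visitTime X (k + 1) ω with hb
  have hlen : (tourWord (fun t => X t ω) k).length = b - a := by
    simp [tourWord, ha, hb, visitTime]
  have hget : ∀ t < b - a, (tourWord (fun t => X t ω) k).getD t none = X (a + t) ω := by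
    intro t ht
    rw [List.getD_eq_getElem _ _ (by rw [hlen]; exact ht)]
    simp [tourWord, ha, visitTime]
  rw [tourSum, wordSum, hlen, ← ha, ← hb, Finset.sum_Ico_eq_sum_range, Finset.sum_Ico_eq_sum_range]
  refine Finset.sum_congr (by rw [Nat.sub_add_eq]) fun t ht => ?_
  have ht : 1 + t < b - a := by
    have := Finset.mem_range.1 ht
    omega
  rw [hget _ (by omega), hget _ ht]
  rw [show a + 1 + t - 1 = a + (1 + t - 1) by omega, show a + 1 + t = a + (1 + t) by omega]

/-- The walk does not return to the super-node during the steps `1, …, t`. -/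
def Alive (X : ℕ → Ω → SuperVertex I) (t : ℕ) (ω : Ω) : Prop :=
  ∀ s, 1 ≤ s → s ≤ t → X s ω ≠ none

theorem measurableSet_alive (hX : IsSuperWalk G I P X) (t : ℕ) :
    MeasurableSet {ω | Alive X t ω} := by
  have : {ω | Alive X t ω} = ⋂ s, ⋂ (_ : 1 ≤ s), ⋂ (_ : s ≤ t), {ω | X s ω = none}ᶜ := by
    ext ω; simp [Alive]
  rw [this]
  exact MeasurableSet.iInter fun s => MeasurableSet.iInter fun _ => MeasurableSet.iInter fun _ =>
    (hX.measurable s none).compl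

/-- The Markov property at time `t`, for events that depend on the walk until time `t`. -/
theorem measureReal_markov (hX : IsSuperWalk G I P X) {t : ℕ}
    {p : (Fin (t + 1) → SuperVertex I) → Prop} (a b : SuperVertex I) :
    P.real {ω | (p (fun s => X s ω) ∧ X t ω = a) ∧ X (t + 1) ω = b} =
      P.real {ω | p (fun s => X s ω) ∧ X t ω = a} * stepProb G I a b := by
  classical
  set Z : Ω → Fin (t + 1) → SuperVertex I := fun ω s => X s ω with hZ
  have hZm : ∀ z, MeasurableSet (Z ⁻¹' {z}) := by
    intro z
    have : Z ⁻¹' {z} = ⋂ s : Fin (t + 1), {ω | X s ω = z s} := by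
      ext ω; simp [hZ, funext_iff]
    rw [this]
    exact MeasurableSet.iInter fun s => hX.measurable s (z s)
  set S : Finset (Fin (t + 1) → SuperVertex I) :=
    Finset.univ.filter fun z => p z ∧ z (Fin.last t) = a with hS
  have e1 : {ω | p (fun s => X s ω) ∧ X t ω = a} =
      Z ⁻¹' (S : Set (Fin (t + 1) → SuperVertex I)) := by
    ext ω; simp [hS, hZ]
  have hbm := hX.measurable (t + 1) b
  have e2 : P.real {ω | (p (fun s => X s ω) ∧ X t ω = a) ∧ X (t + 1) ω = b} =
      (P.restrict {ω | X (t + 1) ω = b}).real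
        (Z ⁻¹' (S : Set (Fin (t + 1) → SuperVertex I))) := by
    rw [measureReal_restrict_apply' hbm, ← e1]
    rfl
  rw [e2, e1, ← sum_measureReal_preimage_singleton S (fun z _ => hZm z),
    ← sum_measureReal_preimage_singleton S (fun z _ => hZm z), Finset.sum_mul]
  refine Finset.sum_congr rfl fun z hz => ?_
  have hza : z (Fin.last t) = a := (Finset.mem_filter.1 hz).2.2
  rw [measureReal_restrict_apply' hbm]
  set x : ℕ → SuperVertex I := fun s => if h : s < t + 1 then z ⟨s, h⟩ else b with hx
  have hxs : ∀ s (h : s < t + 1), x s = z ⟨s, h⟩ := fun s h => dif_pos h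
  have hxt : x t = a := by rw [hxs t (by omega), ← hza]; rfl
  have hxb : x (t + 1) = b := by simp [hx]
  have c1 : Z ⁻¹' {z} = {ω | ∀ s ≤ t, X s ω = x s} := by
    ext ω
    simp only [Set.mem_preimage, Set.mem_singleton_iff, Set.mem_ofPred_eq, hZ, funext_iff]
    constructor
    · intro h s hs
      rw [hxs s (by omega), ← h ⟨s, by omega⟩]
    · intro h s
      rw [h s (by omega), hxs s s.2]
  have c2 : Z ⁻¹' {z} ∩ {ω | X (t + 1) ω = b} = {ω | ∀ s ≤ t + 1, X s ω = x s} := by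
    ext ω
    simp only [c1, Set.mem_inter_iff, Set.mem_ofPred_eq]
    constructor
    · rintro ⟨h, hb⟩ s hs
      rcases Nat.lt_or_ge s (t + 1) with h1 | h1
      · exact h s (by omega)
      · obtain rfl : s = t + 1 := by omega
        rw [hb, hxb]
    · intro h
      exact ⟨fun s hs => h s (by omega), by rw [h _ le_rfl, hxb]⟩
  rw [c2, c1, hX.law, hX.law, Finset.prod_range_succ, hxt, hxb]
  split_ifs <;> simp

theorem measureReal_start (hX : IsSuperWalk G I P X) (a : SuperVertex I) :
    P.real {ω | X 0 ω = a} = if a = none then 1 else 0 := by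
  have := hX.law 0 fun _ => a
  simpa using this

theorem ae_start (hX : IsSuperWalk G I P X) : ∀ᵐ ω ∂P, X 0 ω = none := by
  have h := measureReal_start hX none
  rw [if_pos rfl] at h
  exact (prob_compl_eq_zero_iff (hX.measurable 0 none)).2
    ((ENNReal.toReal_eq_one_iff _).1 h)

theorem measureReal_alive_step (hX : IsSuperWalk G I P X) (t : ℕ) (a b : SuperVertex I) :
    P.real {ω | (Alive X t ω ∧ X t ω = a) ∧ X (t + 1) ω = b} =
      P.real {ω | Alive X t ω ∧ X t ω = a} * stepProb G I a b := by
  have := measureReal_markov hX (t := t)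
    (p := fun z => ∀ s : Fin (t + 1), 1 ≤ (s : ℕ) → z s ≠ none) a b
  have e : ∀ ω, (∀ s : Fin (t + 1), 1 ≤ (s : ℕ) → X s ω ≠ none) ↔ Alive X t ω := fun ω =>
    ⟨fun h s h1 h2 => h ⟨s, by omega⟩ h1, fun h s h1 => h s h1 (by omega)⟩
  simpa only [e] using this

theorem alive_succ_iff {t : ℕ} {ω : Ω} :
    Alive X (t + 1) ω ↔ Alive X t ω ∧ X (t + 1) ω ≠ none := by
  constructor
  · intro h
    exact ⟨fun s h1 h2 => h s h1 (by omega), h _ (by omega) le_rfl⟩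
  · rintro ⟨h, h'⟩ s h1 h2
    rcases Nat.lt_or_ge s (t + 1) with h3 | h3
    · exact h s h1 (by omega)
    · obtain rfl : s = t + 1 := by omega
      exact h'

theorem measureReal_alive_succ (hX : IsSuperWalk G I P X) (t : ℕ) (v : {v : V // v ∉ I}) :
    P.real {ω | Alive X (t + 1) ω ∧ X (t + 1) ω = some v} =
      ∑ a, P.real {ω | Alive X t ω ∧ X t ω = a} * stepProb G I a (some v) := by
  simp_rw [← measureReal_alive_step hX]
  have hd : (↑(Finset.univ : Finset (SuperVertex I)) : Set (SuperVertex I)).PairwiseDisjoint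
      fun a => {ω | (Alive X t ω ∧ X t ω = a) ∧ X (t + 1) ω = some v} := by
    intro a _ b _ hab
    refine Set.disjoint_left.2 fun ω h1 h2 => hab ?_
    exact h1.1.2.symm.trans h2.1.2
  rw [← measureReal_biUnion_finset hd fun a _ =>
    ((measurableSet_alive hX t).inter (hX.measurable t a)).inter (hX.measurable (t + 1) _)]
  congr 1
  ext ω
  simp only [Set.mem_ofPred_eq, Set.mem_iUnion, Finset.mem_univ, exists_prop, true_and,
    alive_succ_iff]
  constructor
  · rintro ⟨⟨h1, -⟩, h2⟩
    exact ⟨_, ⟨h1, rfl⟩, h2⟩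
  · rintro ⟨_, ⟨h1, -⟩, h2⟩
    exact ⟨⟨h1, by simp [h2]⟩, h2⟩

/-- The first step has law p(S, ·) = π - πQ, and each further step without return applies Q to both
terms. -/
theorem measureReal_alive_eq (hX : IsSuperWalk G I P X) (hd : ∀ a, 0 < superDegree G I a) (t : ℕ)
    (v : {v : V // v ∉ I}) :
    P.real {ω | Alive X (t + 1) ω ∧ X (t + 1) ω = some v} =
      killedMass G I t v - killedMass G I (t + 1) v := by
  induction t generalizing v with
  | zero =>
    have h0 : ∀ ω, Alive X 0 ω := fun ω s h1 h2 => by omega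
    rw [measureReal_alive_succ hX, zero_add, killedMass_zero_sub_one hd, Fintype.sum_option]
    simp [h0, measureReal_start hX]
  | succ t ih =>
    rw [measureReal_alive_succ hX, Fintype.sum_option]
    have hnone : {ω | Alive X (t + 1) ω ∧ X (t + 1) ω = none} = ∅ := by
      ext ω
      simp only [Set.mem_ofPred_eq, Set.mem_empty_iff_false, iff_false, not_and, alive_succ_iff]
      exact fun h => h.2
    rw [hnone, measureReal_empty, zero_mul, zero_add, killedMass_succ t, killedMass_succ (t + 1),
      ← Finset.sum_sub_distrib]
    refine Finset.sum_congr rfl fun u _ => ?_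
    rw [ih, sub_mul]

theorem measureReal_alive_le (hX : IsSuperWalk G I P X) (hd : ∀ a, 0 < superDegree G I a)
    (t : ℕ) : P.real {ω | Alive X (t + 1) ω} ≤ ∑ v, killedMass G I t v := by
  have hsub : {ω | Alive X (t + 1) ω} ⊆
      ⋃ v ∈ (Finset.univ : Finset {v : V // v ∉ I}),
        {ω | Alive X (t + 1) ω ∧ X (t + 1) ω = some v} := by
    intro ω hω
    obtain ⟨v, hv⟩ := Option.ne_none_iff_exists'.1 (alive_succ_iff.1 hω).2
    simp only [Finset.mem_univ, Set.iUnion_true, Set.mem_iUnion]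
    exact ⟨v, hω, hv⟩
  refine (measureReal_mono hsub (measure_ne_top _ _)).trans
    ((measureReal_biUnion_finset_le _ _).trans ?_)
  refine Finset.sum_le_sum fun v _ => ?_
  rw [measureReal_alive_eq hX hd]
  linarith [killedMass_nonneg (G := G) (t + 1) v]

theorem ae_return (hX : IsSuperWalk G I P X) (hspan : ∀ v : V, ∃ u ∈ I, G.Reachable u v)
    (hd : ∀ a, 0 < superDegree G I a) : ∀ᵐ ω ∂P, ∃ t, 1 ≤ t ∧ X t ω = none := by
  have hlim : Tendsto (fun t => ∑ v, killedMass G I t v) atTop (𝓝 0) := by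
    simpa using tendsto_finsetSum Finset.univ fun v _ => tendsto_killedMass hspan hd v
  have h0 : P.real {ω | ¬ ∃ t, 1 ≤ t ∧ X t ω = none} ≤ 0 := by
    refine ge_of_tendsto' hlim fun t => ?_
    refine (measureReal_mono ?_).trans (measureReal_alive_le hX hd t)
    intro ω hω s h1 _ h2
    exact hω ⟨s, h1, h2⟩
  have h1 := le_antisymm h0 measureReal_nonneg
  exact (measureReal_eq_zero_iff).1 h1

theorem ae_follows_tourWord (hX : IsSuperWalk G I P X)
    (hspan : ∀ v : V, ∃ u ∈ I, G.Reachable u v) (hd : ∀ a, 0 < superDegree G I a) :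
    ∀ᵐ ω ∂P, IsTour (tourWord (fun t => X t ω) 0) ∧
      Follows (fun t => X t ω) (tourWord (fun t => X t ω) 0 ++ [none]) := by
  filter_upwards [ae_start hX, ae_return hX hspan hd] with ω h0 h1
  exact follows_tourWord_zero h0 h1

theorem measureReal_follows_flatten (hX : IsSuperWalk G I P X)
    {ls : List (List (SuperVertex I))} (h : ∀ l ∈ ls, IsTour l) :
    P.real {ω | Follows (fun t => X t ω) (ls.flatten ++ [none])} =
      (ls.map fun l => chainProb (stepProb G I) (l ++ [none])).prod := by
  obtain ⟨r, hr⟩ := exists_flatten_append_eq_cons h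
  rw [← chainProb_flatten _ h, hr, measureReal_follows hX]

/-- Almost surely the first tour ends, so it equals a given word with at most the chain probability
of that word closed by `none`. Following the concatenated words forces all K tours. Only these two
inclusions are needed, so later returns need no separate argument. -/
theorem prod_measure_tourWord_le (hX : IsSuperWalk G I P X)
    (hspan : ∀ v : V, ∃ u ∈ I, G.Reachable u v) (hd : ∀ a, 0 < superDegree G I a) (K : ℕ)
    (a : Fin K → List (SuperVertex I)) :
    ∏ i, P {ω | tourWord (fun t => X t ω) 0 = a i} ≤
      P {ω | ∀ i : Fin K, tourWord (fun t => X t ω) i = a i} := by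
  by_cases ha : ∀ i, IsTour (a i)
  · have hls : ∀ l ∈ List.ofFn a, IsTour l := by
      intro l hl
      obtain ⟨i, rfl⟩ := (List.mem_ofFn' a l).1 hl
      exact ha i
    have h1 : ∀ i, P {ω | tourWord (fun t => X t ω) 0 = a i} ≤
        ENNReal.ofReal (chainProb (stepProb G I) (a i ++ [none])) := by
      intro i
      have h2 := measureReal_follows_flatten hX (ls := [a i]) (by simpa using ha i)
      simp only [List.flatten_cons, List.flatten_nil, List.append_nil, List.map_cons, List.map_nil,
        List.prod_cons, List.prod_nil, mul_one] at h2
      rw [← h2, ofReal_measureReal]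
      refine measure_mono_ae ?_
      filter_upwards [ae_follows_tourWord hX hspan hd] with ω hω h
      have h : tourWord (fun t => X t ω) 0 = a i := h
      rw [h] at hω
      exact hω.2
    have hnn : ∀ l : List (SuperVertex I), 0 ≤ chainProb (stepProb G I) l := by
      intro l
      induction l with
      | nil => simp [chainProb]
      | cons b l ih =>
        cases l with
        | nil => simp [chainProb]
        | cons c l => exact mul_nonneg (stepProb_nonneg _ _) ih
    calc ∏ i, P {ω | tourWord (fun t => X t ω) 0 = a i}
        ≤ ∏ i, ENNReal.ofReal (chainProb (stepProb G I) (a i ++ [none])) :=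
          Finset.prod_le_prod' fun i _ => h1 i
      _ = ENNReal.ofReal (∏ i, chainProb (stepProb G I) (a i ++ [none])) :=
          (ENNReal.ofReal_prod_of_nonneg fun i _ => hnn _).symm
      _ = P {ω | Follows (fun t => X t ω) ((List.ofFn a).flatten ++ [none])} := by
          rw [← ofReal_measureReal, measureReal_follows_flatten hX hls, List.map_ofFn,
            List.prod_ofFn]
          rfl
      _ ≤ _ := by
          refine measure_mono fun ω hω i => ?_
          -- Cutting the list at position i exhibits `a i` as the tour preceded by exactly i others.
          have hsplit : List.ofFn a =
              (List.ofFn a).take i ++ a i :: (List.ofFn a).drop (i + 1) := by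
            have h1 := List.getElem_ofFn (f := a) (i := i) (by simp)
            conv_lhs => rw [← List.take_append_drop i (List.ofFn a),
              List.drop_eq_getElem_cons (by simp), h1]
          have hω : Follows (fun t => X t ω) ((List.ofFn a).flatten ++ [none]) := hω
          rw [hsplit] at hω hls
          have h2 := tourWord_of_follows hls hω
          rw [List.length_take, List.length_ofFn, min_eq_left i.2.le] at h2
          exact h2
  · push Not at ha
    obtain ⟨i, hi⟩ := ha
    have h0 : P {ω | tourWord (fun t => X t ω) 0 = a i} = 0 := by
      refine measure_mono_null (t := {ω | ¬ (IsTour (tourWord (fun t => X t ω) 0) ∧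
        Follows (fun t => X t ω) (tourWord (fun t => X t ω) 0 ++ [none]))}) ?_
        (ae_follows_tourWord hX hspan hd)
      intro ω hω h
      have hω : tourWord (fun t => X t ω) 0 = a i := hω
      exact hi (hω ▸ h.1)
    rw [Finset.prod_eq_zero (Finset.mem_univ i) h0]
    exact zero_le

/-- The tour sums are independent, identically distributed random variables. -/
theorem iIndepFun_tourSum (hX : IsSuperWalk G I P X)
    (hspan : ∀ v : V, ∃ u ∈ I, G.Reachable u v) (hd : ∀ a, 0 < superDegree G I a)
    (f : Sym2 V → ℝ) :
    (∀ k, Measurable (tourSum f X k)) ∧ iIndepFun (tourSum f X) P ∧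
      ∀ k, IdentDistrib (tourSum f X k) (tourSum f X 0) P P := by
  -- Words form a countable set, so the discrete σ-algebra makes every function of a tour measurable
  -- at no cost.
  let _ : MeasurableSpace (List (SuperVertex I)) := ⊤
  have hT : ∀ k, Measurable fun ω => tourWord (fun t => X t ω) k := fun k =>
    measurable_to_countable' fun l => measurableSet_tourWord_eq hX k l
  obtain ⟨h1, h2⟩ := iIndepFun_of_prod_le hT (prod_measure_tourWord_le hX hspan hd)
  have hg : Measurable (wordSum (I := I) f) := measurable_from_top
  have he : ∀ k, tourSum f X k = wordSum f ∘ fun ω => tourWord (fun t => X t ω) k := fun k =>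
    funext fun ω => tourSum_eq_wordSum f X k ω
  refine ⟨fun k => ?_, ?_, fun k => ?_⟩
  · rw [he]
    exact hg.comp (hT k)
  · have : tourSum f X = fun k => wordSum f ∘ fun ω => tourWord (fun t => X t ω) k := funext he
    rw [this]
    exact h1.comp (fun _ => wordSum f) fun _ => hg
  · rw [he, he]
    exact (h2 k).comp hg

end WalkLaw

/-! ### Exponential moments and mean of a tour sum. -/

section TourMoments

set_option linter.unusedSectionVars false

variable {V : Type*} [Fintype V] [DecidableEq V] {G : SimpleGraph V} [DecidableRel G.Adj]
  {I : Finset V} {Ω : Type*} [MeasurableSpace Ω] {P : Measure Ω} [IsProbabilityMeasure P]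
  {X : ℕ → Ω → SuperVertex I}

theorem ae_exists_tourSum_zero_eq (hX : IsSuperWalk G I P X)
    (hspan : ∀ v : V, ∃ u ∈ I, G.Reachable u v) (hd : ∀ a, 0 < superDegree G I a)
    (f : Sym2 V → ℝ) :
    ∀ᵐ ω ∂P, ∃ N : ℕ, 1 ≤ N ∧ (∀ t, Alive X t ω ↔ t < N) ∧
      tourSum f X 0 ω = ∑ t ∈ Finset.range (N - 1), superFun I f (X t ω) (X (t + 1) ω) := by
  filter_upwards [ae_start hX, ae_follows_tourWord hX hspan hd] with ω h0 h1
  obtain ⟨htour, hf⟩ := h1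
  set l := tourWord (fun t => X t ω) 0 with hl
  have n1 := nth_eq_of_follows (x := fun t => X t ω) (ls := [l]) (by simpa using htour)
    (by simpa using hf)
  simp only [List.length_singleton, List.flatten_cons, List.flatten_nil, List.append_nil] at n1
  have n0 := nth_zero_of_follows (x := fun t => X t ω) h0
  rw [follows_append, follows_singleton] at hf
  have hcount := count_eq_of_follows hf.1
  rw [htour.count_eq] at hcount
  have hpos : 1 ≤ l.length := by
    obtain ⟨w, hw, -⟩ := htour
    rw [hw]; simp
  refine ⟨l.length, hpos, fun t => ⟨fun h => ?_, fun h s h1 h2 hs => ?_⟩, ?_⟩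
  · by_contra ht
    exact h l.length hpos (not_lt.1 ht) (by simpa using hf.2)
  -- Another visit at s with 1 ≤ s < N would be a second `none` in the first tour.
  · have c1 : Nat.count (fun t => X t ω = none) 1 = 1 := by simp [Nat.count_succ, h0]
    have c2 := Nat.count_monotone (fun t => X t ω = none) h1
    have c3 : Nat.count (fun t => X t ω = none) (s + 1) =
        Nat.count (fun t => X t ω = none) s + 1 := by simp [Nat.count_succ, hs]
    have c4 := Nat.count_monotone (fun t => X t ω = none) (show s + 1 ≤ l.length by omega)
    omega
  · rw [tourSum, visitTime, visitTime, n0, n1, zero_add, Finset.sum_Ico_eq_sum_range]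
    refine Finset.sum_congr rfl fun t _ => ?_
    rw [Nat.add_sub_cancel_left, add_comm 1 t]

theorem abs_superFun_le (f : Sym2 V → ℝ) (a b : SuperVertex I) :
    |superFun I f a b| ≤ ∑ a, ∑ b, |superFun I f a b| :=
  (Finset.single_le_sum (f := fun b => |superFun I f a b|) (fun _ _ => abs_nonneg _)
    (Finset.mem_univ b)).trans
    (Finset.single_le_sum (f := fun a => ∑ b, |superFun I f a b|)
      (fun _ _ => Finset.sum_nonneg fun _ _ => abs_nonneg _) (Finset.mem_univ a))

theorem exists_integrable_exp_abs_tourSum (hX : IsSuperWalk G I P X)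
    (hspan : ∀ v : V, ∃ u ∈ I, G.Reachable u v) (hd : ∀ a, 0 < superDegree G I a)
    (f : Sym2 V → ℝ) :
    ∃ l : ℝ, 0 < l ∧ Integrable (fun ω => Real.exp (l * |tourSum f X 0 ω|)) P := by
  obtain ⟨l, hl, hsum⟩ := exists_summable_exp_mul_killedMass hspan hd
  set M := ∑ a, ∑ b, |superFun I f a b| with hM
  have hM0 : 0 ≤ M := Finset.sum_nonneg fun _ _ => Finset.sum_nonneg fun _ _ => abs_nonneg _
  have hmeas := (iIndepFun_tourSum hX hspan hd f).1 0
  refine ⟨l / (M + 1), by positivity, ⟨by fun_prop, ?_⟩⟩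
  rw [hasFiniteIntegral_iff_ofReal (ae_of_all _ fun ω => (Real.exp_pos _).le)]
  -- With N the tour length, N = 1 is covered by e^l; N = t + 2 means survival up to time t + 1, and
  -- the t-th term is then exactly e^{lN}. Dividing l by M + 1 keeps the rate defined when f
  -- vanishes on all relevant edges.
  have hbound : ∀ᵐ ω ∂P, ENNReal.ofReal (Real.exp (l / (M + 1) * |tourSum f X 0 ω|)) ≤
      ENNReal.ofReal (Real.exp l) + ∑' t : ℕ, {ω | Alive X (t + 1) ω}.indicator
        (fun _ => ENNReal.ofReal (Real.exp (l * 2) * Real.exp (l * t))) ω := by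
    filter_upwards [ae_exists_tourSum_zero_eq hX hspan hd f] with ω ⟨N, hN, halive, hW⟩
    have h1 : |tourSum f X 0 ω| ≤ M * N := by
      rw [hW]
      refine (Finset.abs_sum_le_sum_abs _ _).trans ?_
      refine (Finset.sum_le_sum fun t _ => abs_superFun_le f _ _).trans ?_
      rw [Finset.sum_const, Finset.card_range, nsmul_eq_mul, mul_comm, ← hM]
      gcongr
      exact Nat.sub_le _ _
    have h2 : l / (M + 1) * |tourSum f X 0 ω| ≤ l * N := by
      calc l / (M + 1) * |tourSum f X 0 ω| ≤ l / (M + 1) * (M * N) := by gcongr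
        _ = l * N * (M / (M + 1)) := by ring
        _ ≤ l * N * 1 := by
          gcongr
          exact div_le_one_of_le₀ (by linarith) (by linarith)
        _ = l * N := mul_one _
    refine (ENNReal.ofReal_le_ofReal (Real.exp_le_exp.2 h2)).trans ?_
    rcases Nat.lt_or_ge N 2 with h3 | h3
    · obtain rfl : N = 1 := by omega
      simp
    · obtain ⟨t, rfl⟩ : ∃ t, N = t + 2 := ⟨N - 2, by omega⟩
      refine le_trans (le_trans ?_ (ENNReal.le_tsum t)) le_add_self
      rw [Set.indicator_of_mem (show ω ∈ {ω | Alive X (t + 1) ω} from (halive _).2 (by omega)),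
        ← Real.exp_add]
      apply le_of_eq
      congr 2
      push_cast
      ring
  refine (lintegral_mono_ae hbound).trans_lt ?_
  rw [lintegral_add_left measurable_const, lintegral_tsum fun t =>
    (measurable_const.indicator (measurableSet_alive hX (t + 1))).aemeasurable]
  simp only [lintegral_const, measure_univ, mul_one]
  refine ENNReal.add_lt_top.2 ⟨ENNReal.ofReal_lt_top, ?_⟩
  have hs := (hsum.mul_left (Real.exp (l * 2))).tsum_ofReal_lt_top
  refine (ENNReal.tsum_le_tsum fun t => ?_).trans_lt hs
  rw [lintegral_indicator_const (measurableSet_alive hX (t + 1)), ← ofReal_measureReal,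
    ← ENNReal.ofReal_mul (by positivity), ← mul_assoc]
  refine ENNReal.ofReal_le_ofReal ?_
  gcongr
  exact measureReal_alive_le hX hd t

/-- The tour sums have exponential moments. -/
theorem zero_mem_interior_integrableExpSet_tourSum (hX : IsSuperWalk G I P X)
    (hspan : ∀ v : V, ∃ u ∈ I, G.Reachable u v) (hd : ∀ a, 0 < superDegree G I a)
    (f : Sym2 V → ℝ) : 0 ∈ interior (integrableExpSet (tourSum f X 0) P) := by
  obtain ⟨l, hl, hint⟩ := exists_integrable_exp_abs_tourSum hX hspan hd f
  have hmeas := (iIndepFun_tourSum hX hspan hd f).1 0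
  rw [mem_interior]
  refine ⟨Set.Ioo (-l) l, fun s hs => ?_, isOpen_Ioo, by simpa using hl⟩
  refine hint.mono' (by fun_prop) (ae_of_all _ fun ω => ?_)
  rw [Real.norm_eq_abs, abs_of_pos (Real.exp_pos _)]
  refine Real.exp_le_exp.2 ((le_abs_self _).trans ?_)
  rw [abs_mul]
  gcongr
  exact (abs_lt.2 hs).le

theorem hasSum_measureReal_alive (hX : IsSuperWalk G I P X)
    (hspan : ∀ v : V, ∃ u ∈ I, G.Reachable u v) (hd : ∀ a, 0 < superDegree G I a)
    (u : {v : V // v ∉ I}) :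
    HasSum (fun t => P.real {ω | Alive X t ω ∧ X t ω = some u})
      ((superDegree G I (some u) : ℝ) / superDegree G I none) := by
  have h0 : P.real {ω | Alive X 0 ω ∧ X 0 ω = some u} = 0 := by
    refine le_antisymm ?_ measureReal_nonneg
    have h := measureReal_start hX (some u)
    rw [if_neg (by simp)] at h
    rw [← h]
    exact measureReal_mono fun ω hω => hω.2
  -- The term t = 0 is zero because the walk starts at the super-node; the others telescope.
  rw [← hasSum_nat_add_iff' 1, Finset.sum_range_one, h0, sub_zero,
    hasSum_iff_tendsto_nat_of_nonneg fun _ => measureReal_nonneg]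
  simp_rw [measureReal_alive_eq hX hd, Finset.sum_range_sub']
  have := (tendsto_killedMass hspan hd u).const_sub (killedMass G I 0 u)
  rw [sub_zero] at this
  exact this

open scoped Classical in
/-- The contribution of the step `t → t + 1` to the sum along the first tour. -/
def stepTerm (f : Sym2 V → ℝ) (X : ℕ → Ω → SuperVertex I) (t : ℕ) (ω : Ω) : ℝ :=
  if Alive X (t + 1) ω then superFun I f (X t ω) (X (t + 1) ω) else 0

theorem stepTerm_eq_sum (f : Sym2 V → ℝ) (X : ℕ → Ω → SuperVertex I) (t : ℕ) (ω : Ω) :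
    stepTerm f X t ω = ∑ u : {v : V // v ∉ I}, ∑ v : {v : V // v ∉ I},
      {ω | (Alive X t ω ∧ X t ω = some u) ∧ X (t + 1) ω = some v}.indicator
        (fun _ => superFun I f (some u) (some v)) ω := by
  classical
  rw [stepTerm]
  simp only [Set.indicator_apply, Set.mem_ofPred_eq, alive_succ_iff]
  by_cases ha : Alive X t ω
  · obtain hu | ⟨u, hu⟩ := Option.eq_none_or_eq_some (X t ω)
    · simp [hu, superFun]
    obtain hv | ⟨v, hv⟩ := Option.eq_none_or_eq_some (X (t + 1) ω)
    · simp [hv]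
    simp only [ha, hu, hv, true_and, ne_eq, reduceCtorEq, not_false_eq_true, if_true,
      Option.some.injEq]
    rw [Finset.sum_eq_single u, Finset.sum_eq_single v]
    · simp
    · intro w _ hw
      rw [if_neg fun h => hw h.2.symm]
    · simp
    · intro w _ hw
      exact Finset.sum_eq_zero fun _ _ => if_neg fun h => hw h.1.symm
    · simp
  · simp [ha]

theorem measurableSet_alive_step (hX : IsSuperWalk G I P X) (t : ℕ) (a b : SuperVertex I) :
    MeasurableSet {ω | (Alive X t ω ∧ X t ω = a) ∧ X (t + 1) ω = b} :=
  ((measurableSet_alive hX t).inter (hX.measurable t a)).inter (hX.measurable (t + 1) b)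

theorem integral_stepTerm (hX : IsSuperWalk G I P X) (f : Sym2 V → ℝ) (t : ℕ) :
    Integrable (stepTerm f X t) P ∧ ∫ ω, stepTerm f X t ω ∂P =
      ∑ u : {v : V // v ∉ I}, ∑ v : {v : V // v ∉ I},
        P.real {ω | Alive X t ω ∧ X t ω = some u} *
          (stepProb G I (some u) (some v) * superFun I f (some u) (some v)) := by
  have hi : ∀ u v : {v : V // v ∉ I}, Integrable
      ({ω | (Alive X t ω ∧ X t ω = some u) ∧ X (t + 1) ω = some v}.indicator
        (fun _ => superFun I f (some u) (some v))) P := fun u v =>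
    (integrable_const _).indicator (measurableSet_alive_step hX t _ _)
  have he : stepTerm f X t = fun ω => ∑ u : {v : V // v ∉ I}, ∑ v : {v : V // v ∉ I},
      {ω | (Alive X t ω ∧ X t ω = some u) ∧ X (t + 1) ω = some v}.indicator
        (fun _ => superFun I f (some u) (some v)) ω := funext fun ω => stepTerm_eq_sum f X t ω
  rw [he]
  refine ⟨integrable_finsetSum _ fun u _ => integrable_finsetSum _ fun v _ => hi u v, ?_⟩
  rw [integral_finsetSum _ fun u _ => integrable_finsetSum _ fun v _ => hi u v]
  refine Finset.sum_congr rfl fun u _ => ?_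
  rw [integral_finsetSum _ fun v _ => hi u v]
  refine Finset.sum_congr rfl fun v _ => ?_
  rw [integral_indicator_const _ (measurableSet_alive_step hX t _ _),
    measureReal_alive_step hX, smul_eq_mul, mul_assoc]

theorem ae_tourSum_zero_eq_tsum (hX : IsSuperWalk G I P X)
    (hspan : ∀ v : V, ∃ u ∈ I, G.Reachable u v) (hd : ∀ a, 0 < superDegree G I a)
    (f : Sym2 V → ℝ) : ∀ᵐ ω ∂P, tourSum f X 0 ω = ∑' t, stepTerm f X t ω := by
  filter_upwards [ae_exists_tourSum_zero_eq hX hspan hd f] with ω ⟨N, hN, halive, hW⟩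
  rw [tsum_eq_sum (s := Finset.range (N - 1)), hW]
  · refine Finset.sum_congr rfl fun t ht => ?_
    have := Finset.mem_range.1 ht
    rw [stepTerm, if_pos ((halive _).2 (by omega))]
  · intro t ht
    have := mt Finset.mem_range.2 ht
    rw [stepTerm, if_neg fun h => ?_]
    have := (halive _).1 h
    omega

theorem integral_tourSum (hX : IsSuperWalk G I P X)
    (hspan : ∀ v : V, ∃ u ∈ I, G.Reachable u v) (hd : ∀ a, 0 < superDegree G I a)
    (f : Sym2 V → ℝ) :
    ∫ ω, tourSum f X 0 ω ∂P =
      2 * (edgeTotal G f - seedTotal G I f) / superDegree G I none := by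
  set M := ∑ a, ∑ b, |superFun I f a b| with hM
  have hM0 : 0 ≤ M := Finset.sum_nonneg fun _ _ => Finset.sum_nonneg fun _ _ => abs_nonneg _
  have hnorm : ∀ t, ∫ ω, ‖stepTerm f X t ω‖ ∂P ≤ M * ∑ v, killedMass G I t v := by
    intro t
    calc ∫ ω, ‖stepTerm f X t ω‖ ∂P ≤ ∫ ω, {ω | Alive X (t + 1) ω}.indicator (fun _ => M) ω ∂P := by
          refine integral_mono (integral_stepTerm hX f t).1.norm
            ((integrable_const _).indicator (measurableSet_alive hX (t + 1))) fun ω => ?_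
          by_cases h : Alive X (t + 1) ω
          · simp only [stepTerm, if_pos h, Real.norm_eq_abs]
            rw [Set.indicator_of_mem (by exact h)]
            exact abs_superFun_le f _ _
          · simp only [stepTerm, if_neg h, norm_zero]
            rw [Set.indicator_of_notMem (by exact h)]
      _ = P.real {ω | Alive X (t + 1) ω} * M := by
          rw [integral_indicator_const _ (measurableSet_alive hX (t + 1)), smul_eq_mul]
      _ ≤ _ := by
          rw [mul_comm]
          gcongr
          exact measureReal_alive_le hX hd t
  -- This justifies exchanging expectation and sum over time; since l > 0, the weights e^{lt} are at
  -- least 1 and the exponential summability suffices.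
  have hsummable : Summable fun t => ∫ ω, ‖stepTerm f X t ω‖ ∂P := by
    obtain ⟨l, hl, hsum⟩ := exists_summable_exp_mul_killedMass hspan hd
    refine Summable.of_nonneg_of_le (fun t => integral_nonneg fun _ => norm_nonneg _) (fun t => ?_)
      (hsum.mul_left M)
    refine (hnorm t).trans ?_
    gcongr
    refine le_mul_of_one_le_left (Finset.sum_nonneg fun v _ => killedMass_nonneg t v) ?_
    rw [Real.one_le_exp_iff]
    positivity
  have h1 := hasSum_integral_of_summable_integral_norm (fun t => (integral_stepTerm hX f t).1)
    hsummable
  have h2 : HasSum (fun t => ∫ ω, stepTerm f X t ω ∂P)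
      (∑ u : {v : V // v ∉ I}, ∑ v : {v : V // v ∉ I},
        (superDegree G I (some u) : ℝ) / superDegree G I none *
          (stepProb G I (some u) (some v) * superFun I f (some u) (some v))) := by
    simp_rw [(integral_stepTerm hX f _).2]
    exact hasSum_sum fun u _ => hasSum_sum fun v _ =>
      (hasSum_measureReal_alive hX hspan hd u).mul_right _
  rw [integral_congr_ae (ae_tourSum_zero_eq_tsum hX hspan hd f), h1.unique h2,
    ← sum_edgeMult_mul_superFun, Finset.sum_div]
  refine Finset.sum_congr rfl fun u _ => ?_
  rw [Finset.sum_div]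
  refine Finset.sum_congr rfl fun v _ => ?_
  rw [← superDegree_mul_stepProb (hd (some u))]
  ring

end TourMoments

/-! ### Back to the estimators: assembling the three parts. -/

section Batches

variable {V : Type*} [Fintype V] [DecidableEq V] (G : SimpleGraph V) [DecidableRel G.Adj]
  {I : Finset V} {Ω : Type*}

theorem sum_blockSum (W : ℕ → Ω → ℝ) (n r : ℕ) (ω : Ω) :
    ∑ h : Fin r, blockSum W n h ω = ∑ k ∈ Finset.range (r * n), W k ω := by
  rw [Fin.sum_univ_eq_sum_range (fun h => blockSum W n h ω)]
  induction r with
  | zero => simp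
  | succ r ih =>
    rw [Finset.sum_range_succ, ih, blockSum,
      Finset.sum_range_add_sum_Ico _ (Nat.mul_le_mul_right n r.le_succ)]

/-- The sums along the tours, normalized as in the estimators. -/
def scaledTourSum (f : Sym2 V → ℝ) (X : ℕ → Ω → SuperVertex I) (k : ℕ) (ω : Ω) : ℝ :=
  (superDegree G I none : ℝ) / 2 * tourSum f X k ω

theorem tourEstimator_eq (f : Sym2 V → ℝ) (X : ℕ → Ω → SuperVertex I) (m : ℕ) (ω : Ω) :
    tourEstimator G f X m ω =
      (∑ k ∈ Finset.range m, scaledTourSum G f X k ω) / m + seedTotal G I f := by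
  simp only [tourEstimator, scaledTourSum, ← Finset.mul_sum]
  ring

theorem batchEstimate_eq (f : Sym2 V → ℝ) (X : ℕ → Ω → SuperVertex I) (m h : ℕ) (ω : Ω) :
    batchEstimate G f X m h ω =
      (m.sqrt : ℝ)⁻¹ * blockSum (scaledTourSum G f X) m.sqrt h ω + seedTotal G I f := by
  simp only [batchEstimate, blockSum, scaledTourSum, ← Finset.mul_sum]
  ring

theorem sum_batchEstimate_div (f : Sym2 V → ℝ) (X : ℕ → Ω → SuperVertex I) {m : ℕ}
    (hm : m.sqrt ≠ 0) (ω : Ω) :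
    (∑ h : Fin m.sqrt, batchEstimate G f X m h ω) / m.sqrt =
      (∑ k ∈ Finset.range (m.sqrt * m.sqrt), scaledTourSum G f X k ω) / (m.sqrt * m.sqrt : ℕ) +
        seedTotal G I f := by
  have hm : (m.sqrt : ℝ) ≠ 0 := by exact_mod_cast hm
  simp only [batchEstimate_eq, Finset.sum_add_distrib, ← Finset.mul_sum, sum_blockSum]
  simp only [Finset.sum_const, Finset.card_univ, Fintype.card_fin, nsmul_eq_mul]
  push_cast
  field_simp

variable {G} [MeasurableSpace Ω] {P : Measure Ω}

theorem variance_scaledTourSum (f : Sym2 V → ℝ) (X : ℕ → Ω → SuperVertex I) :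
    variance (scaledTourSum G f X 0) P =
      ((superDegree G I none : ℝ) / 2) ^ 2 * variance (tourSum f X 0) P :=
  variance_const_mul _ _ _

variable [IsProbabilityMeasure P] {X : ℕ → Ω → SuperVertex I}

theorem iIndepFun_scaledTourSum (hX : IsSuperWalk G I P X)
    (hspan : ∀ v : V, ∃ u ∈ I, G.Reachable u v) (hd : ∀ a, 0 < superDegree G I a)
    (f : Sym2 V → ℝ) :
    (∀ k, Measurable (scaledTourSum G f X k)) ∧ iIndepFun (scaledTourSum G f X) P ∧
      ∀ k, IdentDistrib (scaledTourSum G f X k) (scaledTourSum G f X 0) P P := by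
  obtain ⟨hmeas, hind, hid⟩ := iIndepFun_tourSum hX hspan hd f
  have hc : Measurable fun x : ℝ => (superDegree G I none : ℝ) / 2 * x := by fun_prop
  exact ⟨fun k => hc.comp (hmeas k), hind.comp _ fun _ => hc, fun k => (hid k).comp hc⟩

theorem memLp_scaledTourSum (hX : IsSuperWalk G I P X)
    (hspan : ∀ v : V, ∃ u ∈ I, G.Reachable u v) (hd : ∀ a, 0 < superDegree G I a)
    (f : Sym2 V → ℝ) : MemLp (scaledTourSum G f X 0) 2 P := by
  have h := memLp_of_mem_interior_integrableExpSet
    (zero_mem_interior_integrableExpSet_tourSum hX hspan hd f) 2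
  exact MemLp.const_mul (by exact_mod_cast h) _

theorem integral_scaledTourSum (hX : IsSuperWalk G I P X)
    (hspan : ∀ v : V, ∃ u ∈ I, G.Reachable u v) (hd : ∀ a, 0 < superDegree G I a)
    (f : Sym2 V → ℝ) :
    ∫ ω, scaledTourSum G f X 0 ω ∂P = edgeTotal G f - seedTotal G I f := by
  have : (superDegree G I none : ℝ) ≠ 0 := by exact_mod_cast (hd none).ne'
  simp only [scaledTourSum]
  rw [integral_const_mul, integral_tourSum hX hspan hd f]
  field_simp

/-- The batch estimates are i.i.d., unbiased, and have finite variance. -/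
theorem iIndepFun_batchEstimate (hX : IsSuperWalk G I P X)
    (hspan : ∀ v : V, ∃ u ∈ I, G.Reachable u v) (hd : ∀ a, 0 < superDegree G I a)
    (f : Sym2 V → ℝ) {m : ℕ} (hm : 1 ≤ m) :
    iIndepFun (fun h : ℕ => batchEstimate G f X m h) P ∧
      ∀ h : ℕ, IdentDistrib (batchEstimate G f X m h) (batchEstimate G f X m 0) P P ∧
        MemLp (batchEstimate G f X m h) 2 P ∧
        ∫ ω, batchEstimate G f X m h ω ∂P = edgeTotal G f ∧
        variance (batchEstimate G f X m h) P =
          ((superDegree G I none : ℝ) / 2) ^ 2 * variance (tourSum f X 0) P / (m.sqrt : ℝ) := by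
  obtain ⟨hmeas, hind, hid⟩ := iIndepFun_scaledTourSum hX hspan hd f
  have hL := memLp_scaledTourSum hX hspan hd f
  have hn : (m.sqrt : ℝ) ≠ 0 := by exact_mod_cast (Nat.sqrt_pos.2 hm).ne'
  have he : ∀ h, batchEstimate G f X m h = fun ω =>
      (m.sqrt : ℝ)⁻¹ * blockSum (scaledTourSum G f X) m.sqrt h ω + seedTotal G I f :=
    fun h => funext fun ω => batchEstimate_eq G f X m h ω
  have hc : Measurable fun x : ℝ => (m.sqrt : ℝ)⁻¹ * x + seedTotal G I f := by fun_prop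
  have hLb := fun h => memLp_blockSum hid hL m.sqrt h
  simp only [he]
  refine ⟨(iIndepFun_blockSum hmeas hind m.sqrt).comp _ fun _ => hc, fun h => ⟨?_, ?_, ?_, ?_⟩⟩
  · exact ((identDistrib_blockSum hind hid m.sqrt h).trans
      (identDistrib_blockSum hind hid m.sqrt 0).symm).comp hc
  · exact ((hLb h).const_mul _).add (memLp_const _)
  · rw [integral_add (((hLb h).const_mul _).integrable (by norm_num)) (integrable_const _),
      integral_const_mul, integral_blockSum hid hL, integral_scaledTourSum hX hspan hd f]
    simp [hn]
  · rw [variance_add_const ((hLb h).const_mul _).aestronglyMeasurable, variance_const_mul,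
      variance_blockSum hind hid hL, variance_scaledTourSum]
    field_simp

/-- The central limit theorem for the batch estimates. -/
theorem tendstoInDistribution_batchEstimate (hX : IsSuperWalk G I P X)
    (hspan : ∀ v : V, ∃ u ∈ I, G.Reachable u v) (hd : ∀ a, 0 < superDegree G I a)
    (f : Sym2 V → ℝ) (r : ℕ) :
    TendstoInDistribution
      (fun (m : ℕ) (ω : Ω) (h : Fin r) =>
        Real.sqrt (m.sqrt : ℝ) * (batchEstimate G f X m h ω - edgeTotal G f))
      atTop (fun y : Fin r → ℝ => y) (fun _ => P)
      (Measure.pi fun _ : Fin r => gaussianReal 0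
        (((superDegree G I none : ℝ) / 2) ^ 2 * variance (tourSum f X 0) P).toNNReal) := by
  obtain ⟨hmeas, hind, hid⟩ := iIndepFun_scaledTourSum hX hspan hd f
  have h := tendstoInDistribution_blockSum hmeas hind hid (memLp_scaledTourSum hX hspan hd f) r
  rw [variance_scaledTourSum, integral_scaledTourSum hX hspan hd f] at h
  convert! h using 4 with m ω i
  rw [batchEstimate_eq]
  -- For m = 0 both sides vanish, by √0 = 0 and 0⁻¹ = 0.
  rcases Nat.eq_zero_or_pos m.sqrt with hn | hn
  · simp [hn]
  · have hn : (0 : ℝ) < m.sqrt := by exact_mod_cast hn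
    have hs := Real.sqrt_pos.2 hn
    have hsq := Real.sq_sqrt hn.le
    generalize blockSum (scaledTourSum G f X) m.sqrt i ω = B
    rw [← hsq, Real.sqrt_sq hs.le]
    field_simp
    ring

theorem isProbabilityMeasure_marginalPosterior {m₀ ν₀ σ₀ : ℝ} (hm₀ : 0 < m₀) (hν₀ : 0 < ν₀)
    (hσ₀ : 0 < σ₀) (μ₀ : ℝ) {n : ℕ} (hn : n ≠ 0) (y : Fin n → ℝ) :
    IsProbabilityMeasure (marginalPosterior μ₀ m₀ ν₀ σ₀ y) := by
  rw [marginalPosterior_eq_studentMeasure hm₀ hν₀ hσ₀ μ₀ hn]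
  exact isProbabilityMeasure_studentMeasure (by positivity) (postScale_pos hm₀ hν₀ hσ₀ μ₀ _ _) _

/-- The marginal posterior at the batch estimates is asymptotically a Student distribution. -/
theorem ae_tendstoTotalVariation_marginalPosterior (hX : IsSuperWalk G I P X)
    (hspan : ∀ v : V, ∃ u ∈ I, G.Reachable u v) (hd : ∀ a, 0 < superDegree G I a)
    (f : Sym2 V → ℝ) {m₀ ν₀ σ₀ : ℝ} (hm₀ : 0 < m₀) (hν₀ : 0 < ν₀) (hσ₀ : 0 < σ₀) (μ₀ : ℝ) :
    ∀ᵐ ω ∂P, TendstoTotalVariation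
      (fun m => marginalPosterior μ₀ m₀ ν₀ σ₀
        fun h : Fin m.sqrt => batchEstimate G f X m h ω)
      (fun m => studentMeasure (ν₀ + (m.sqrt : ℝ))
        (postLocation μ₀ m₀ m.sqrt (tourEstimator G f X m ω))
        (postScale μ₀ m₀ ν₀ σ₀ (tourEstimator G f X m ω)
          fun h : Fin m.sqrt => batchEstimate G f X m h ω)) := by
  obtain ⟨-, hind, hid⟩ := iIndepFun_tourSum hX hspan hd f
  have h0 := zero_mem_interior_integrableExpSet_tourSum hX hspan hd f
  filter_upwards [ae_tendsto_averages hind hid h0] with ω ⟨h1, h2⟩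
  have hm : ∀ᶠ m : ℕ in atTop, m.sqrt ≠ 0 := tendsto_natSqrt.eventually_ne_atTop 0
  refine tendstoTotalVariation_marginalPosterior hm₀ hν₀ hσ₀ μ₀
    (e := (superDegree G I none : ℝ) / 2 * P[tourSum f X 0] + seedTotal G I f) ?_ ?_
  · refine ((h1.const_mul _).add_const _).congr' ?_
    filter_upwards [hm] with m hm
    rw [sum_batchEstimate_div G f X hm]
    simp only [scaledTourSum, ← Finset.mul_sum, mul_div_assoc]
  -- The seed total cancels; the sign is negative because here the average over all tours is
  -- subtracted from the batch mean.
  · have h3 := h2.const_mul (-((superDegree G I none : ℝ) / 2))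
    rw [mul_zero] at h3
    refine h3.congr' ?_
    filter_upwards [hm] with m hm
    rw [sum_batchEstimate_div G f X hm, tourEstimator_eq]
    simp only [scaledTourSum, ← Finset.mul_sum, mul_div_assoc]
    ring

end Batches

end CrawlTours

end

theorem mainTheorem3 {V : Type*} [Fintype V] [DecidableEq V]
    (G : SimpleGraph V) [DecidableRel G.Adj] (I : Finset V)
    (hspan : ∀ v : V, ∃ u ∈ I, G.Reachable u v) (hproper : ∃ v : V, v ∉ I)
    (f : Sym2 V → ℝ)
    {Ω : Type*} [MeasurableSpace Ω] (P : Measure Ω) [IsProbabilityMeasure P]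
    (X : ℕ → Ω → CrawlTours.SuperVertex I) (hX : CrawlTours.IsSuperWalk G I P X)
    (μ₀ m₀ ν₀ σ₀ : ℝ) (hm₀ : 0 < m₀) (hν₀ : 0 < ν₀) (hσ₀ : 0 < σ₀) :
    -- the batch estimates are i.i.d. with mean `μ(G)` and finite variance
    (∀ m : ℕ, 1 ≤ m →
      iIndepFun (fun h : ℕ => CrawlTours.batchEstimate G f X m h) P ∧
      ∀ h : ℕ,
        IdentDistrib (CrawlTours.batchEstimate G f X m h) (CrawlTours.batchEstimate G f X m 0) P P ∧
        MemLp (CrawlTours.batchEstimate G f X m h) 2 P ∧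
        ∫ ω, CrawlTours.batchEstimate G f X m h ω ∂P = CrawlTours.edgeTotal G f ∧
        variance (CrawlTours.batchEstimate G f X m h) P =
          ((CrawlTours.superDegree G I none : ℝ) / 2) ^ 2 *
            variance (CrawlTours.tourSum f X 0) P / (m.sqrt : ℝ)) ∧
    -- any fixed number of them, centred and rescaled, tend jointly to i.i.d. normal variables
    (∀ r : ℕ,
      TendstoInDistribution
        (fun (m : ℕ) (ω : Ω) (h : Fin r) =>
          Real.sqrt (m.sqrt : ℝ) *
            (CrawlTours.batchEstimate G f X m h ω - CrawlTours.edgeTotal G f))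
        atTop (fun y : Fin r → ℝ => y) (fun _ => P)
        (Measure.pi fun _ : Fin r => gaussianReal 0
          (((CrawlTours.superDegree G I none : ℝ) / 2) ^ 2 *
            variance (CrawlTours.tourSum f X 0) P).toNNReal)) ∧
    -- almost surely, the marginal posterior approaches the Student distribution
    (∀ᵐ ω ∂P,
      (∀ m : ℕ, 1 ≤ m → IsProbabilityMeasure
        (CrawlTours.marginalPosterior μ₀ m₀ ν₀ σ₀
          fun h : Fin m.sqrt => CrawlTours.batchEstimate G f X m h ω)) ∧
      CrawlTours.TendstoTotalVariation
        (fun m => CrawlTours.marginalPosterior μ₀ m₀ ν₀ σ₀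
          fun h : Fin m.sqrt => CrawlTours.batchEstimate G f X m h ω)
        (fun m => CrawlTours.studentMeasure (ν₀ + (m.sqrt : ℝ))
          (CrawlTours.postLocation μ₀ m₀ m.sqrt (CrawlTours.tourEstimator G f X m ω))
          (CrawlTours.postScale μ₀ m₀ ν₀ σ₀ (CrawlTours.tourEstimator G f X m ω)
            fun h : Fin m.sqrt => CrawlTours.batchEstimate G f X m h ω))) := by
  have hd := CrawlTours.superDegree_pos hspan hproper
  refine ⟨fun m hm => CrawlTours.iIndepFun_batchEstimate hX hspan hd f hm,
    fun r => CrawlTours.tendstoInDistribution_batchEstimate hX hspan hd f r, ?_⟩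
  filter_upwards [CrawlTours.ae_tendstoTotalVariation_marginalPosterior hX hspan hd f hm₀ hν₀ hσ₀
    μ₀] with ω hω
  exact ⟨fun m hm => CrawlTours.isProbabilityMeasure_marginalPosterior hm₀ hν₀ hσ₀ μ₀
    (Nat.sqrt_pos.2 hm).ne' _, hω⟩
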